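/- Let $n,d_1,d_2\ge 1$, $1\le r\le d_1\wedge d_2$, $\sigma_\xi>0$. For $M\in\mathbb{R}^{d_1\times d_2}$ consider the trace regression model $$y_i=\langle X_i,M\rangle+\xi_i,\qquad i=1,\dots,n,\qquad \langle X,M\rangle=\operatorname{Tr}(X^\top M),$$ where $X_1,\dots,X_n,\xi_1,\dots,\xi_n$ are independent, $\xi_i\sim\mathcal N(0,\sigma_\xi^2)$ and $\operatorname{vec}(X_i)\sim\mathcal N(0,\Lambda_i)$ with fixed symmetric positive definite $\Lambda_i$ such that $C_l\le\lambda_{\min}(\Lambda_i)\le\lambda_{\max}(\Lambda_i)\le C_u$ (Gaussian design), and write $Z=((X_1,y_1),\dots,(X_n,y_n))$. A randomized algorithm $A$ (a Markov kernel from data sets to $\mathbb{R}^{d_1\times d_2}$) is $(\varepsilon,\delta)$-differentially private if $\mathbb P(A(Z)\in Q)\le e^{\varepsilon}\,\mathbb P(A(Z')\in Q)+\delta$ for all data sets $Z,Z'$ differing in at most one observation and all measurable $Q\subset\mathbb{R}^{d_1\times d_2}$. Let $\mathbb M_k=\{M\in\mathbb{R}^{d_1\times d_2}:\operatorname{rank}(M)=k\}$.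 For all constants $C_l,C_u,C_1,C_2,\gamma>0$ there is a constant $c>0$, depending only on these, such that for all $n,d_1,d_2,r,\sigma_\xi,(\Lambda_i)$ as above and all $\varepsilon,\delta$ with $$r(d_1\vee d_2)\le C_1\,n\varepsilon,\qquad 0<\varepsilon<1,\qquad 0\le\delta\le C_2\,n^{-(1+\gamma)},$$ one has $$\inf_{A}\ \sup_{M\in\bigcup_{k=1}^r\mathbb M_k}\mathbb E\,\|A(Z)-M\|_F^2\ \ge\ c\left(\sigma_\xi^2\,\frac{r(d_1\vee d_2)}{n}+\sigma_\xi^2\,\frac{r^2(d_1\vee d_2)^2}{n^2\varepsilon^2}\right),$$ where the infimum is over all $(\varepsilon,\delta)$-differentially private algorithms $A$ and the expectation is over $Z$ (generated with parameter $M$) and the randomness of $A$. -/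

import Mathlib

open MeasureTheory ProbabilityTheory

namespace TraceRegression

noncomputable section

/-- Matrices carry the product (equivalently, the Borel) σ-algebra of their entries. -/
instance instMeasurableSpaceMatrix {m n : Type*} : MeasurableSpace (Matrix m n ℝ) :=
  inferInstanceAs (MeasurableSpace (m → n → ℝ))

instance instBorelSpaceMatrix {m n : Type*} [Countable m] [Countable n] :
    BorelSpace (Matrix m n ℝ) :=
  inferInstanceAs (BorelSpace (m → n → ℝ))

/-- `mat`, the inverse of the column-stacking vectorization `Matrix.vec`. -/
def mat {d₁ d₂ : ℕ} (v : EuclideanSpace ℝ (Fin d₂ × Fin d₁)) : Matrix (Fin d₁) (Fin d₂) ℝ :=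
  Matrix.of fun i j => v (j, i)

theorem vec_mat {d₁ d₂ : ℕ} (v : EuclideanSpace ℝ (Fin d₂ × Fin d₁)) :
    Matrix.vec (mat v) = v := rfl

/-- The inner product `⟨X, M⟩ = Tr(Xᵀ M)`. -/
def traceInner {d₁ d₂ : ℕ} (X M : Matrix (Fin d₁) (Fin d₂) ℝ) : ℝ := (X.transpose * M).trace

/-- One observation `z = (X, y)`. -/
abbrev Obs (d₁ d₂ : ℕ) : Type := Matrix (Fin d₁) (Fin d₂) ℝ × ℝ

/-- A data set `Z = (z₁, …, zₙ)`. -/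
abbrev Dataset (n d₁ d₂ : ℕ) : Type := Fin n → Obs d₁ d₂

/-- Gaussian design: the covariance matrices `Λ₁, …, Λₙ` of `vec X₁, …, vec Xₙ` are symmetric
positive definite with all eigenvalues in `[C_l, C_u]`. -/
def IsGaussianDesignCov {n d₁ d₂ : ℕ} (Cl Cu : ℝ)
    (Λ : Fin n → Matrix (Fin d₂ × Fin d₁) (Fin d₂ × Fin d₁) ℝ) : Prop :=
  ∀ i, ∃ h : (Λ i).PosDef, ∀ k, Cl ≤ h.isHermitian.eigenvalues k ∧ h.isHermitian.eigenvalues k ≤ Cu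

/-- The law of a measurement matrix `X` with `vec X ∼ N(0, Λ)`. -/
def designLaw {d₁ d₂ : ℕ} (Λ : Matrix (Fin d₂ × Fin d₁) (Fin d₂ × Fin d₁) ℝ) :
    Measure (Matrix (Fin d₁) (Fin d₂) ℝ) :=
  (multivariateGaussian 0 Λ).map mat

theorem measurable_mat {d₁ d₂ : ℕ} :
    Measurable (mat : EuclideanSpace ℝ (Fin d₂ × Fin d₁) → Matrix (Fin d₁) (Fin d₂) ℝ) := by
  refine measurable_pi_iff.2 fun i => measurable_pi_iff.2 fun j => ?_
  change Measurable fun v : EuclideanSpace ℝ (Fin d₂ × Fin d₁) => v (j, i)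
  fun_prop

instance isProbabilityMeasure_designLaw {d₁ d₂ : ℕ}
    (Λ : Matrix (Fin d₂ × Fin d₁) (Fin d₂ × Fin d₁) ℝ) : IsProbabilityMeasure (designLaw Λ) :=
  Measure.isProbabilityMeasure_map measurable_mat.aemeasurable

/-- The law of `(X, y)`, `y = ⟨X, M⟩ + ξ`, with `vec X ∼ N(0, Λ)` and `ξ ∼ N(0, σ²)` independent. -/
def obsLaw {d₁ d₂ : ℕ} (σ : ℝ) (Λ : Matrix (Fin d₂ × Fin d₁) (Fin d₂ × Fin d₁) ℝ)
    (M : Matrix (Fin d₁) (Fin d₂) ℝ) : Measure (Obs d₁ d₂) :=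
  ((designLaw Λ).prod (gaussianReal 0 (σ ^ 2).toNNReal)).map
    fun p => (p.1, traceInner p.1 M + p.2)

theorem measurable_obs {d₁ d₂ : ℕ} (M : Matrix (Fin d₁) (Fin d₂) ℝ) :
    Measurable fun p : Matrix (Fin d₁) (Fin d₂) ℝ × ℝ => (p.1, traceInner p.1 M + p.2) := by
  refine measurable_fst.prodMk (Measurable.add ?_ measurable_snd)
  simp only [traceInner, Matrix.trace, Matrix.diag, Matrix.mul_apply, Matrix.transpose_apply]
  refine Finset.measurable_sum _ fun i _ => Finset.measurable_sum _ fun j _ =>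
    Measurable.mul_const ?_ _
  exact (measurable_pi_apply i).comp ((measurable_pi_apply j).comp measurable_fst)

instance isProbabilityMeasure_obsLaw {d₁ d₂ : ℕ} (σ : ℝ)
    (Λ : Matrix (Fin d₂ × Fin d₁) (Fin d₂ × Fin d₁) ℝ) (M : Matrix (Fin d₁) (Fin d₂) ℝ) :
    IsProbabilityMeasure (obsLaw σ Λ M) :=
  Measure.isProbabilityMeasure_map (measurable_obs M).aemeasurable

/-- The law of the sample `Z = ((X₁, y₁), …, (Xₙ, yₙ))` of independent observations. -/
def sampleLaw {n d₁ d₂ : ℕ} (σ : ℝ)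
    (Λ : Fin n → Matrix (Fin d₂ × Fin d₁) (Fin d₂ × Fin d₁) ℝ)
    (M : Matrix (Fin d₁) (Fin d₂) ℝ) : Measure (Dataset n d₁ d₂) :=
  Measure.pi fun i => obsLaw σ (Λ i) M

/-- Neighbouring data sets differ in at most one observation. -/
def Neighbouring {n d₁ d₂ : ℕ} (Z Z' : Dataset n d₁ d₂) : Prop :=
  ∃ i, ∀ j, j ≠ i → Z j = Z' j

/-- A randomized algorithm is a Markov kernel from data sets to matrices: `A Z` is the law of its
output on the data set `Z`. It is `(ε, δ)`-differentially private if
`P(A(Z) ∈ Q) ≤ e^ε P(A(Z') ∈ Q) + δ` for all neighbouring `Z, Z'` and all measurable `Q`. -/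
structure IsDPAlgorithm {n d₁ d₂ : ℕ} (ε δ : ℝ)
    (A : Kernel (Dataset n d₁ d₂) (Matrix (Fin d₁) (Fin d₂) ℝ)) : Prop where
  isMarkov : IsMarkovKernel A
  private_ineq : ∀ Z Z' : Dataset n d₁ d₂, Neighbouring Z Z' →
    ∀ Q : Set (Matrix (Fin d₁) (Fin d₂) ℝ), MeasurableSet Q →
      A Z Q ≤ ENNReal.ofReal (Real.exp ε) * A Z' Q + ENNReal.ofReal δ

section

open scoped Matrix.Norms.Frobenius

/-- The risk `E ‖A(Z) - M‖_F²` (possibly `∞`), over both the sample and the algorithm. -/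
def risk {n d₁ d₂ : ℕ} (σ : ℝ)
    (Λ : Fin n → Matrix (Fin d₂ × Fin d₁) (Fin d₂ × Fin d₁) ℝ)
    (A : Kernel (Dataset n d₁ d₂) (Matrix (Fin d₁) (Fin d₂) ℝ))
    (M : Matrix (Fin d₁) (Fin d₂) ℝ) : ENNReal :=
  ∫⁻ Z, ∫⁻ B, ENNReal.ofReal (‖B - M‖ ^ 2) ∂(A Z) ∂(sampleLaw σ Λ M)

end

/-- The set `𝕄_k` of `d₁ × d₂` matrices of rank `k`. -/
def rankSet (d₁ d₂ k : ℕ) : Set (Matrix (Fin d₁) (Fin d₂) ℝ) := {M | M.rank = k}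

/-- The minimax risk over `Θ` of `(ε, δ)`-differentially private algorithms. -/
def minimaxRisk {n d₁ d₂ : ℕ} (σ ε δ : ℝ)
    (Λ : Fin n → Matrix (Fin d₂ × Fin d₁) (Fin d₂ × Fin d₁) ℝ)
    (Θ : Set (Matrix (Fin d₁) (Fin d₂) ℝ)) : ENNReal :=
  ⨅ (A : Kernel (Dataset n d₁ d₂) (Matrix (Fin d₁) (Fin d₂) ℝ)) (_ : IsDPAlgorithm ε δ A),
    ⨆ M ∈ Θ, risk σ Λ A M

end

end TraceRegression

/-!
The matrices supported on the first `r` columns (if `d₁ ≥ d₂`) or the first `r` rows (otherwise)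
have rank at most `r` and `p = r max(d₁, d₂)` free entries, so estimating `M` is at least as hard as
estimating a vector `β ∈ ℝᵖ` in linear regression with Gaussian design
(`exists_low_rank_coordinates`, `linRisk_entries_le`).

The lower bound for `β` is a score attack under the Gaussian prior `β ∼ N(0, a² I)`. It compares two
estimates of the correlation between the error `T - β` of an estimator and the score
`∑ᵢ ξᵢ xᵢ` of the sample.

* From below (`le_integral_correlation`): given the design, the score of the joint law of `β` and
  the sample is a linear form in a standard Gaussian vector that is orthogonal to all responses. A
  reflection thus flips its sign and keeps the data, so it is uncorrelated with every estimator
  (`integral_mul_dot_eq_zero_of_translation_invariant`). Hence the average correlation is `σ² / a²`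
  times `E ⟨T, β⟩`, which is at least `σ² p / 2` once the average error is at most `a² p / 4`.
* From above, by the Cauchy–Schwarz inequality (`correlation_le`), the correlation is at most of the
  order `(ρ n σ² p)^(1/2)` for the average error `ρ`; this yields the rate `σ² p / n`.
* From above, by privacy (`correlation_le_of_private`): the term of observation `i` has mean zero
  once this observation is replaced by an independent copy in the input of the algorithm. The
  replacement costs about `ε` times the mean absolute value of the term, so the correlation is at
  most of the order `n ε (ρ σ²)^(1/2)`; this yields the rate `σ² p² / (n² ε²)`.

The `δ` in the privacy condition costs `n δ` times the mean of a pointwise bound on one term. To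
have such a bound, the estimator is clipped at a radius of order `σ`, which is harmless because
`p ≤ C₁ n ε` keeps the prior at the scale of the noise. Since `n δ ≤ C₂ n^(-γ)`, this cost is
negligible for large `n`. For bounded `n` the condition `p ≤ C₁ n ε` bounds `ε` from below, and the
second rate is dominated by the first.
-/

open MeasureTheory ProbabilityTheory

namespace TraceRegression

noncomputable section

/-! ### A Gaussian reflection principle -/

/-- Stein-type orthogonality without calculus: if `f` is invariant under translations along `v`,
then `f` is uncorrelated with the linear form `⟨v, ·⟩` under the standard Gaussian distribution.
The reflection in the hyperplane orthogonal to `v` preserves the distribution and `f`, and reverses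
the sign of the linear form. -/
theorem integral_mul_dot_eq_zero_of_translation_invariant {κ : Type*} [Fintype κ] (v : κ → ℝ)
    (f : (κ → ℝ) → ℝ) (hf : ∀ (u : κ → ℝ) (c : ℝ), f (u + c • v) = f u) :
    ∫ u, f u * ∑ k, v k * u k ∂(Measure.pi fun _ : κ => gaussianReal 0 1) = 0 := by
  classical
  let E := EuclideanSpace ℝ κ
  let w : E := WithLp.toLp 2 v
  let ρ : E ≃ₗᵢ[ℝ] E := (Submodule.span ℝ {w}).reflection.trans (LinearIsometryEquiv.neg ℝ)
  have hρa : ∀ x, ρ x = -(Submodule.span ℝ {w}).reflection x := fun x => rfl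
  have hρ : ∀ x : E, ∃ c : ℝ, ρ x = x + c • w := by
    intro x
    refine ⟨-(2 * (inner ℝ w x / ‖w‖ ^ 2)), ?_⟩
    rw [hρa, Submodule.reflection_singleton_apply (𝕜 := ℝ) w x]
    simp only [RCLike.ofReal_real_eq_id, id_eq]
    module
  have hw : ∀ x : E, inner ℝ w (ρ x) = - inner ℝ w x := by
    intro x
    rw [hρa, inner_neg_right]
    have h1 : (Submodule.span ℝ {w}).reflection w = w :=
      Submodule.reflection_mem_subspace_eq_self (Submodule.mem_span_singleton_self w)
    have h2 := LinearIsometryEquiv.inner_map_map (Submodule.span ℝ {w}).reflection w x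
    rw [h1] at h2
    rw [h2]
  let F : E → ℝ := fun x => f x.ofLp * inner ℝ w x
  have hF : ∀ x, F (ρ x) = - F x := by
    intro x
    obtain ⟨c, hc⟩ := hρ x
    have : f (ρ x).ofLp = f x.ofLp := by
      rw [hc]; exact hf _ _
    simp only [F, this, hw]; ring
  have hmp : MeasurePreserving ρ (stdGaussian E) (stdGaussian E) :=
    ⟨ρ.continuous.measurable, stdGaussian_map ρ⟩
  have h0 : ∫ x, F x ∂(stdGaussian E) = 0 := by
    have := hmp.integral_comp ρ.toHomeomorph.measurableEmbedding F
    simp only [hF, integral_neg] at this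
    linarith
  have hmp2 : MeasurePreserving (WithLp.toLp 2 : (κ → ℝ) → E)
      (Measure.pi fun _ : κ => gaussianReal 0 1) (stdGaussian E) :=
    ⟨by fun_prop, map_pi_eq_stdGaussian⟩
  have h1 := hmp2.integral_comp (MeasurableEquiv.toLp 2 (κ → ℝ)).measurableEmbedding F
  rw [h0] at h1
  refine Eq.trans ?_ h1
  refine integral_congr_ae (Filter.Eventually.of_forall fun u => ?_)
  simp only [F, w]
  congr 1
  refine Finset.sum_congr rfl fun k _ => ?_
  simp [mul_comm]

/-! ### Expectations of indistinguishable laws -/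

theorem integrable_integral_kernel {α Θ : Type*} [MeasurableSpace α] [MeasurableSpace Θ]
    {P : Measure α} {κ : Kernel α Θ} [IsMarkovKernel κ] {G : α × Θ → ℝ} (hG : Measurable G)
    {b : α → ℝ} (hb : Integrable b P) (hGb : ∀ a θ, |G (a, θ)| ≤ b a) :
    Integrable (fun a => ∫ θ, G (a, θ) ∂(κ a)) P := by
  refine Integrable.mono' hb ?_ (ae_of_all _ fun a => ?_)
  · exact (StronglyMeasurable.integral_kernel_prod_right'
      hG.stronglyMeasurable).aestronglyMeasurable
  · refine (norm_integral_le_integral_norm _).trans ?_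
    refine (integral_mono_of_nonneg (ae_of_all _ fun θ => norm_nonneg _)
      (integrable_const (b a)) (ae_of_all _ fun θ => hGb a θ)).trans ?_
    simp

section Privacy

variable {Θ : Type*} [MeasurableSpace Θ]

/-- The approximate domination `P ≤ e^ε P' + δ` on events passes to bounded nonnegative functions,
by the layer cake formula. -/
theorem lintegral_le_of_forall_measure_le {P P' : Measure Θ} {ε δ b : ℝ}
    (hδ : 0 ≤ δ)
    (h : ∀ Q, MeasurableSet Q → P Q ≤ ENNReal.ofReal (Real.exp ε) * P' Q + ENNReal.ofReal δ)
    {f : Θ → ℝ} (hf : Measurable f) (hf0 : ∀ θ, 0 ≤ f θ) (hfb : ∀ θ, f θ ≤ b) :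
    ∫⁻ θ, ENNReal.ofReal (f θ) ∂P ≤
      ENNReal.ofReal (Real.exp ε) * ∫⁻ θ, ENNReal.ofReal (f θ) ∂P' + ENNReal.ofReal (δ * b) := by
  have hmeas : Measurable fun t : ℝ => P' {θ | t ≤ f θ} :=
    Antitone.measurable fun s t hst => measure_mono fun θ hθ => le_trans hst hθ
  rw [lintegral_eq_lintegral_meas_le P (ae_of_all _ hf0) hf.aemeasurable,
    lintegral_eq_lintegral_meas_le P' (ae_of_all _ hf0) hf.aemeasurable]
  calc ∫⁻ t in Set.Ioi 0, P {θ | t ≤ f θ}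
      ≤ ∫⁻ t in Set.Ioi 0, (ENNReal.ofReal (Real.exp ε) * P' {θ | t ≤ f θ}
          + (Set.Iic b).indicator (fun _ => ENNReal.ofReal δ) t) := by
        refine lintegral_mono fun t => ?_
        by_cases ht : t ≤ b
        · simpa [Set.indicator, ht] using h _ (measurableSet_le measurable_const hf)
        · have : {θ | t ≤ f θ} = ∅ := by
            ext θ; simpa using lt_of_le_of_lt (hfb θ) (not_le.1 ht)
          simp [this]
    _ = _ := by
        rw [lintegral_add_left (hmeas.const_mul _), lintegral_const_mul _ hmeas,
          lintegral_indicator measurableSet_Iic, lintegral_const,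
          Measure.restrict_restrict measurableSet_Iic, Measure.restrict_apply_univ,
          Set.Iic_inter_Ioi, Real.volume_Ioc, sub_zero, ENNReal.ofReal_mul hδ]

theorem integral_le_of_forall_measure_le {P P' : Measure Θ} [IsProbabilityMeasure P]
    [IsProbabilityMeasure P'] {ε δ b : ℝ} (hδ : 0 ≤ δ)
    (h : ∀ Q, MeasurableSet Q → P Q ≤ ENNReal.ofReal (Real.exp ε) * P' Q + ENNReal.ofReal δ)
    {f : Θ → ℝ} (hf : Measurable f) (hf0 : ∀ θ, 0 ≤ f θ) (hfb : ∀ θ, f θ ≤ b) :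
    ∫ θ, f θ ∂P ≤ Real.exp ε * ∫ θ, f θ ∂P' + δ * b := by
  have hb : 0 ≤ b := by
    obtain ⟨θ⟩ : Nonempty Θ := P.nonempty_of_neZero
    exact (hf0 θ).trans (hfb θ)
  have hi : ∀ ν : Measure Θ, IsProbabilityMeasure ν → Integrable f ν := fun ν _ =>
    Integrable.of_bound hf.aestronglyMeasurable b
      (ae_of_all _ fun θ => by rw [Real.norm_of_nonneg (hf0 θ)]; exact hfb θ)
  have key := lintegral_le_of_forall_measure_le hδ h hf hf0 hfb
  rw [← ofReal_integral_eq_lintegral_ofReal (hi P inferInstance) (ae_of_all _ hf0),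
    ← ofReal_integral_eq_lintegral_ofReal (hi P' inferInstance) (ae_of_all _ hf0),
    ← ENNReal.ofReal_mul (Real.exp_pos _).le, ← ENNReal.ofReal_add] at key
  · refine (ENNReal.ofReal_le_ofReal_iff ?_).1 key
    have := integral_nonneg (μ := P') (f := f) hf0
    positivity
  · have := integral_nonneg (μ := P') (f := f) hf0
    positivity
  · positivity

/-- Two `(ε, δ)`-indistinguishable laws give nearly the same mean to a function bounded by `b`. The
error is measured by the first absolute moment under `P'` alone, and `b` enters only through `δ`. -/
theorem integral_le_integral_add_of_indistinguishable {P P' : Measure Θ}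
    [IsProbabilityMeasure P] [IsProbabilityMeasure P'] {ε δ b : ℝ} (hε : 0 ≤ ε) (hδ : 0 ≤ δ)
    (h : ∀ Q, MeasurableSet Q → P Q ≤ ENNReal.ofReal (Real.exp ε) * P' Q + ENNReal.ofReal δ)
    (h' : ∀ Q, MeasurableSet Q → P' Q ≤ ENNReal.ofReal (Real.exp ε) * P Q + ENNReal.ofReal δ)
    {f : Θ → ℝ} (hf : Measurable f) (hfb : ∀ θ, |f θ| ≤ b) :
    ∫ θ, f θ ∂P ≤ ∫ θ, f θ ∂P' + (Real.exp ε - 1) * ∫ θ, |f θ| ∂P' + 2 * δ * b := by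
  have hb : 0 ≤ b := by
    obtain ⟨θ⟩ : Nonempty Θ := P.nonempty_of_neZero
    exact (abs_nonneg _).trans (hfb θ)
  have hp : Measurable fun θ => max (f θ) 0 := hf.max measurable_const
  have hm : Measurable fun θ => max (-f θ) 0 := hf.neg.max measurable_const
  have hpb : ∀ θ, max (f θ) 0 ≤ b := fun θ => max_le ((le_abs_self _).trans (hfb θ)) hb
  have hmb : ∀ θ, max (-f θ) 0 ≤ b := fun θ => max_le ((neg_le_abs _).trans (hfb θ)) hb
  have hpi : ∀ ν : Measure Θ, IsProbabilityMeasure ν → Integrable (fun θ => max (f θ) 0) ν :=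
    fun ν _ => Integrable.of_bound hp.aestronglyMeasurable b
      (ae_of_all _ fun θ => by rw [Real.norm_of_nonneg (le_max_right _ _)]; exact hpb θ)
  have hmi : ∀ ν : Measure Θ, IsProbabilityMeasure ν → Integrable (fun θ => max (-f θ) 0) ν :=
    fun ν _ => Integrable.of_bound hm.aestronglyMeasurable b
      (ae_of_all _ fun θ => by rw [Real.norm_of_nonneg (le_max_right _ _)]; exact hmb θ)
  have hsub : ∀ ν : Measure Θ, IsProbabilityMeasure ν →
      ∫ θ, f θ ∂ν = ∫ θ, max (f θ) 0 ∂ν - ∫ θ, max (-f θ) 0 ∂ν := fun ν hν => by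
    rw [← integral_sub (hpi ν hν) (hmi ν hν)]
    refine integral_congr_ae (ae_of_all _ fun θ => ?_)
    rcases le_total (f θ) 0 with h0 | h0
    · simp [h0]
    · simp [h0]
  have habs : ∫ θ, |f θ| ∂P' = ∫ θ, max (f θ) 0 ∂P' + ∫ θ, max (-f θ) 0 ∂P' := by
    rw [← integral_add (hpi P' inferInstance) (hmi P' inferInstance)]
    refine integral_congr_ae (ae_of_all _ fun θ => ?_)
    rcases le_total (f θ) 0 with h0 | h0
    · simp [h0, abs_of_nonpos h0]
    · simp [h0, abs_of_nonneg h0]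
  have k1 := integral_le_of_forall_measure_le hδ h hp (fun θ => le_max_right _ _) hpb
  have k2 := integral_le_of_forall_measure_le hδ h' hm (fun θ => le_max_right _ _) hmb
  rw [hsub P inferInstance, hsub P' inferInstance, habs]
  set x := ∫ θ, max (f θ) 0 ∂P
  set x' := ∫ θ, max (f θ) 0 ∂P'
  set y := ∫ θ, max (-f θ) 0 ∂P
  set y' := ∫ θ, max (-f θ) 0 ∂P'
  have hy0 : 0 ≤ y := integral_nonneg fun θ => le_max_right _ _
  have hy0' : 0 ≤ y' := integral_nonneg fun θ => le_max_right _ _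
  have he : 1 ≤ Real.exp ε := Real.one_le_exp hε
  -- From `y' ≤ e^ε y + δ b` and `1 ≤ e^ε`: `y' - y ≤ (e^ε - 1) y' + δ b`.
  have k3 : y' - y ≤ (Real.exp ε - 1) * y' + δ * b := by
    have hδb : 0 ≤ δ * b := by positivity
    by_cases hc : y' ≤ y
    · nlinarith [mul_nonneg (sub_nonneg.2 he) hy0']
    · nlinarith [mul_nonneg (sub_nonneg.2 he) (sub_nonneg.2 (not_le.1 hc).le)]
  nlinarith

end Privacy

/-! ### Replacing one observation of a private algorithm -/

section Resampling

variable {𝒵 Θ : Type*} [MeasurableSpace 𝒵] [MeasurableSpace Θ] {n : ℕ}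

/-- Exchanging the `i`-th coordinates of two independent samples with the same law preserves their
joint law. -/
theorem measurePreserving_swap_coordinate (P : Fin n → Measure 𝒵)
    [∀ i, IsProbabilityMeasure (P i)] (i : Fin n) :
    MeasurePreserving
      (fun p : (Fin n → 𝒵) × (Fin n → 𝒵) =>
        (Function.update p.1 i (p.2 i), Function.update p.2 i (p.1 i)))
      ((Measure.pi P).prod (Measure.pi P)) ((Measure.pi P).prod (Measure.pi P)) := by
  have h1 := measurePreserving_arrowProdEquivProdArrow 𝒵 𝒵 (Fin n) P P
  let s : Fin n → 𝒵 × 𝒵 → 𝒵 × 𝒵 := fun j => if j = i then Prod.swap else id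
  have h2 : MeasurePreserving (fun (a : Fin n → 𝒵 × 𝒵) j => s j (a j))
      (Measure.pi fun j => (P j).prod (P j)) (Measure.pi fun j => (P j).prod (P j)) := by
    refine measurePreserving_pi _ _ fun j => ?_
    by_cases hj : j = i
    · simp only [s, hj, if_true]; exact Measure.measurePreserving_swap
    · simp only [s, hj, if_false]; exact MeasurePreserving.id _
  convert h1.comp (h2.comp (h1.symm)) using 1
  funext p
  refine Prod.ext (funext fun j => ?_) (funext fun j => ?_)
  all_goals
    by_cases hj : j = i
    · subst hj
      simp [s, MeasurableEquiv.arrowProdEquivProdArrow, Equiv.arrowProdEquivProdArrow]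
    · simp [s, hj, MeasurableEquiv.arrowProdEquivProdArrow, Equiv.arrowProdEquivProdArrow]

/-- The output of a private algorithm depends little on a single observation. Replacing `Z i` by an
independent copy makes the output independent of `Z i`, so that the mean of `G (θ, Z i)` becomes
zero and its absolute mean is controlled by `K`; privacy bounds the price of the replacement. The
pointwise bound `b` may be an unbounded function of the observation, since it enters only through
its mean. -/
theorem integral_kernel_eval_le_of_private {P : Fin n → Measure 𝒵}
    [∀ i, IsProbabilityMeasure (P i)] {A : Kernel (Fin n → 𝒵) Θ} [IsMarkovKernel A] {ε δ : ℝ}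
    (hε : 0 ≤ ε) (hδ : 0 ≤ δ) (i : Fin n)
    (hA : ∀ Z Z' : Fin n → 𝒵, (∀ j, j ≠ i → Z j = Z' j) → ∀ Q, MeasurableSet Q →
      A Z Q ≤ ENNReal.ofReal (Real.exp ε) * A Z' Q + ENNReal.ofReal δ)
    {G : Θ × 𝒵 → ℝ} (hG : Measurable G) {b : 𝒵 → ℝ} (hb : Integrable b (P i))
    (hGb : ∀ θ z, |G (θ, z)| ≤ b z) (hG0 : ∀ θ, ∫ z, G (θ, z) ∂(P i) = 0)
    {K : Θ → ℝ} (hK : Measurable K) {C : ℝ} (hKC : ∀ θ, |K θ| ≤ C)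
    (hGK : ∀ θ, ∫ z, |G (θ, z)| ∂(P i) ≤ K θ) :
    ∫ Z, ∫ θ, G (θ, Z i) ∂(A Z) ∂(Measure.pi P) ≤
      (Real.exp ε - 1) * ∫ Z, ∫ θ, K θ ∂(A Z) ∂(Measure.pi P) + 2 * δ * ∫ z, b z ∂(P i) := by
  set PP := (Measure.pi P).prod (Measure.pi P) with hPP
  let S : (Fin n → 𝒵) × (Fin n → 𝒵) → (Fin n → 𝒵) × (Fin n → 𝒵) := fun p =>
    (Function.update p.1 i (p.2 i), Function.update p.2 i (p.1 i))
  have hS : MeasurePreserving S PP PP := measurePreserving_swap_coordinate P i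
  let A₁ : Kernel ((Fin n → 𝒵) × (Fin n → 𝒵)) Θ := A.comap Prod.fst measurable_fst
  -- `Φ g (Z, Z')` averages `g (θ, Z' i)` over the output `θ` of the algorithm on `Z`.
  let Φ : (Θ × 𝒵 → ℝ) → (Fin n → 𝒵) × (Fin n → 𝒵) → ℝ := fun g p => ∫ θ, g (θ, p.2 i) ∂(A p.1)
  have hevb : Integrable (fun Z : Fin n → 𝒵 => b (Z i)) (Measure.pi P) := integrable_comp_eval hb
  have hΦi : ∀ g : Θ × 𝒵 → ℝ, Measurable g → (∀ θ z, |g (θ, z)| ≤ b z) →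
      Integrable (Φ g) PP := by
    intro g hg hgb
    exact integrable_integral_kernel (κ := A₁)
      (G := fun q : ((Fin n → 𝒵) × (Fin n → 𝒵)) × Θ => g (q.2, q.1.2 i))
      (hg.comp (by fun_prop)) (hevb.comp_snd (Measure.pi P)) fun p θ => hgb θ _
  have hΦint : ∀ g : Θ × 𝒵 → ℝ, Measurable g → (∀ θ z, |g (θ, z)| ≤ b z) →
      ∫ p, Φ g p ∂PP = ∫ Z, ∫ θ, ∫ z, g (θ, z) ∂(P i) ∂(A Z) ∂(Measure.pi P) := by
    intro g hg hgb
    rw [hPP, integral_prod _ (hΦi g hg hgb)]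
    refine integral_congr_ae (ae_of_all _ fun Z => ?_)
    have hswap : ∫ Z' : Fin n → 𝒵, ∫ θ, g (θ, Z' i) ∂(A Z) ∂(Measure.pi P) =
        ∫ θ, ∫ Z' : Fin n → 𝒵, g (θ, Z' i) ∂(Measure.pi P) ∂(A Z) := by
      refine integral_integral_swap (f := fun (Z' : Fin n → 𝒵) θ => g (θ, Z' i)) ?_
      refine Integrable.mono' (hevb.comp_fst (A Z)) ?_ (ae_of_all _ fun p => hgb _ _)
      exact (hg.comp (measurable_snd.prodMk
        ((measurable_pi_apply i).comp measurable_fst))).aestronglyMeasurable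
    simp only [Φ]
    rw [hswap]
    refine integral_congr_ae (ae_of_all _ fun θ => ?_)
    exact integral_comp_eval (μ := P) (f := fun z => g (θ, z))
      (hg.comp measurable_prodMk_left).aestronglyMeasurable
  have hGa : Measurable fun q => |G q| := hG.abs
  have hGab : ∀ θ z, |(|G (θ, z)|)| ≤ b z := fun θ z => by rw [abs_abs]; exact hGb θ z
  have hΦS : ∀ g, ∫ p, Φ g (S p) ∂PP = ∫ p, Φ g p ∂PP := fun g => by
    have hinv : Function.Involutive S := fun p => by
      refine Prod.ext (funext fun j => ?_) (funext fun j => ?_) <;>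
      · by_cases hj : j = i
        · subst hj; simp [S]
        · simp [S, hj]
    exact hS.integral_comp
      (MeasurableEquiv.ofInvolutive S hinv hS.measurable).measurableEmbedding _
  have hKi : Integrable (fun Z => ∫ θ, K θ ∂(A Z)) (Measure.pi P) :=
    integrable_integral_kernel (G := fun q => K q.2) (hK.comp measurable_snd)
      (integrable_const C) fun Z θ => hKC θ
  have hLHSi : Integrable (fun p : (Fin n → 𝒵) × (Fin n → 𝒵) => ∫ θ, G (θ, p.1 i) ∂(A p.1)) PP := by
    exact integrable_integral_kernel (κ := A₁)
      (G := fun q : ((Fin n → 𝒵) × (Fin n → 𝒵)) × Θ => G (q.2, q.1.1 i))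
      (hG.comp (by fun_prop)) (hevb.comp_fst (Measure.pi P)) fun p θ => hGb θ _
  have hLHS : ∫ Z, ∫ θ, G (θ, Z i) ∂(A Z) ∂(Measure.pi P) =
      ∫ p : (Fin n → 𝒵) × (Fin n → 𝒵), ∫ θ, G (θ, p.1 i) ∂(A p.1) ∂PP := by
    rw [hPP, integral_prod _ hLHSi]
    simp
  have hI1 : Integrable (fun p => Φ G (S p)) PP := hS.integrable_comp_of_integrable (hΦi G hG hGb)
  have hI2 : Integrable (fun p => Φ (fun q => |G q|) (S p)) PP :=
    hS.integrable_comp_of_integrable (hΦi _ hGa hGab)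
  have hI3 : Integrable (fun p : (Fin n → 𝒵) × (Fin n → 𝒵) => b (p.1 i)) PP :=
    hevb.comp_fst (Measure.pi P)
  calc ∫ Z, ∫ θ, G (θ, Z i) ∂(A Z) ∂(Measure.pi P)
      = ∫ p : (Fin n → 𝒵) × (Fin n → 𝒵), ∫ θ, G (θ, p.1 i) ∂(A p.1) ∂PP := hLHS
    _ ≤ ∫ p, (Φ G (S p) + (Real.exp ε - 1) * Φ (fun q => |G q|) (S p) + 2 * δ * b (p.1 i)) ∂PP := by
        refine integral_mono hLHSi ((hI1.add (hI2.const_mul _)).add (hI3.const_mul _)) fun p => ?_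
        have hS2 : (S p).2 i = p.1 i := by simp [S]
        have hS1 : ∀ j, j ≠ i → p.1 j = (S p).1 j := fun j hj => by simp [S, hj]
        simp only [Φ, hS2]
        exact integral_le_integral_add_of_indistinguishable hε hδ (hA _ _ hS1)
          (hA _ _ fun j hj => (hS1 j hj).symm) (hG.comp measurable_prodMk_right)
          (fun θ => hGb θ _)
    _ = ∫ p, Φ G p ∂PP + (Real.exp ε - 1) * ∫ p, Φ (fun q => |G q|) p ∂PP
          + 2 * δ * ∫ z, b z ∂(P i) := by
        have hI12 : Integrable (fun p => Φ G (S p)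
            + (Real.exp ε - 1) * Φ (fun q => |G q|) (S p)) PP := hI1.add (hI2.const_mul _)
        rw [integral_add hI12 (hI3.const_mul _), integral_add hI1 (hI2.const_mul _),
          integral_const_mul, integral_const_mul, hΦS G,
          hΦS fun q => |G q|]
        congr 2
        rw [hPP, integral_prod _ hI3]
        simp only [integral_const, probReal_univ, one_smul]
        exact integral_comp_eval hb.aestronglyMeasurable
    _ ≤ _ := by
        rw [hΦint G hG hGb, hΦint _ hGa hGab]
        simp only [hG0, integral_zero, zero_add]
        have he : 0 ≤ Real.exp ε - 1 := sub_nonneg.2 (Real.one_le_exp hε)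
        refine add_le_add (mul_le_mul_of_nonneg_left ?_ he) le_rfl
        refine integral_mono_of_nonneg (ae_of_all _ fun Z => integral_nonneg fun θ =>
          integral_nonneg fun z => abs_nonneg _) hKi (ae_of_all _ fun Z => ?_)
        refine integral_mono_of_nonneg (ae_of_all _ fun θ =>
          integral_nonneg fun z => abs_nonneg _) ?_ (ae_of_all _ fun θ => hGK θ)
        exact Integrable.of_bound hK.aestronglyMeasurable C (ae_of_all _ hKC)

end Resampling

/-! ### The linear regression model and its score -/

section Model

variable {ι 𝒳 : Type*} [Fintype ι] {n : ℕ}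

variable {φ : 𝒳 → EuclideanSpace ℝ ι} {σ C : ℝ}

/-- The score `(y - ⟨φ x, β⟩) φ x` of the observation `z = (x, y)`, that is, `σ²` times the gradient
in `β` of its log-likelihood. -/
def score (φ : 𝒳 → EuclideanSpace ℝ ι) (β : EuclideanSpace ℝ ι) (z : 𝒳 × ℝ) :
    EuclideanSpace ℝ ι :=
  (z.2 - inner ℝ (φ z.1) β) • φ z.1

/-- The score of the whole sample. -/
def totalScore (φ : 𝒳 → EuclideanSpace ℝ ι) (β : EuclideanSpace ℝ ι) (Z : Fin n → 𝒳 × ℝ) :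
    EuclideanSpace ℝ ι :=
  ∑ i, score φ β (Z i)

/-- The sample as a function of the parameter `β`, the covariates `q.1` and the standardized noise
`q.2`. -/
def linData (φ : 𝒳 → EuclideanSpace ℝ ι) (σ : ℝ) (β : EuclideanSpace ℝ ι)
    (q : (Fin n → 𝒳) × (Fin n → ℝ)) : Fin n → 𝒳 × ℝ :=
  fun i => (q.1 i, inner ℝ (φ (q.1 i)) β + σ * q.2 i)

theorem inner_score_linObs (v β : EuclideanSpace ℝ ι) (p : 𝒳 × ℝ) :
    inner ℝ v (score φ β (p.1, inner ℝ (φ p.1) β + p.2)) = inner ℝ (φ p.1) v * p.2 := by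
  simp only [score, inner_smul_right, add_sub_cancel_left, real_inner_comm v]
  ring

theorem totalScore_linData (β : EuclideanSpace ℝ ι) (q : (Fin n → 𝒳) × (Fin n → ℝ)) :
    totalScore φ β (linData φ σ β q) = ∑ i, (σ * q.2 i) • φ (q.1 i) := by
  simp [totalScore, linData, score]

variable [MeasurableSpace 𝒳]

/-- The law of `(x, y)`, `y = ⟨φ x, β⟩ + ξ`, for a covariate `x` of law `μ` with feature vector
`φ x` and an independent noise `ξ ∼ N(0, σ²)`. -/
def linObsLaw (φ : 𝒳 → EuclideanSpace ℝ ι) (σ : ℝ) (μ : Measure 𝒳) (β : EuclideanSpace ℝ ι) :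
    Measure (𝒳 × ℝ) :=
  (μ.prod (gaussianReal 0 (σ ^ 2).toNNReal)).map fun p => (p.1, inner ℝ (φ p.1) β + p.2)

/-- The feature vector `φ x` of a covariate `x` of law `μ` has a second moment matrix bounded above
by `C`. -/
structure IsBoundedDesign (φ : 𝒳 → EuclideanSpace ℝ ι) (C : ℝ) (μ : Measure 𝒳) : Prop where
  measurable : Measurable φ
  memLp : ∀ v, MemLp (fun x => inner ℝ (φ x) v) 2 μ
  integral_sq_le : ∀ v, ∫ x, inner ℝ (φ x) v ^ 2 ∂μ ≤ C * ‖v‖ ^ 2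

theorem measurable_linObs (hφ : Measurable φ) (β : EuclideanSpace ℝ ι) :
    Measurable fun p : 𝒳 × ℝ => (p.1, inner ℝ (φ p.1) β + p.2) :=
  measurable_fst.prodMk ((((hφ.comp measurable_fst).inner measurable_const)).add measurable_snd)

theorem isProbabilityMeasure_linObsLaw (hφ : Measurable φ) (μ : Measure 𝒳)
    [IsProbabilityMeasure μ] (β : EuclideanSpace ℝ ι) :
    IsProbabilityMeasure (linObsLaw φ σ μ β) :=
  Measure.isProbabilityMeasure_map (measurable_linObs hφ β).aemeasurable

theorem measurable_score (hφ : Measurable φ) (β : EuclideanSpace ℝ ι) :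
    Measurable (score φ β) :=
  (measurable_snd.sub ((hφ.comp measurable_fst).inner measurable_const)).smul
    (hφ.comp measurable_fst)

/-- Parseval's identity in the standard basis, in the form that transfers moment bounds from linear
forms to the norm. -/
theorem sum_sq_inner_single [DecidableEq ι] (w : EuclideanSpace ℝ ι) :
    ‖w‖ ^ 2 = ∑ k, inner ℝ (EuclideanSpace.single k (1 : ℝ)) w ^ 2 := by
  rw [EuclideanSpace.real_norm_sq_eq]
  simp [EuclideanSpace.inner_single_left]

theorem integral_sq_gaussianReal (σ : ℝ) :
    ∫ x, x ^ 2 ∂(gaussianReal 0 (σ ^ 2).toNNReal) = σ ^ 2 := by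
  have h := variance_fun_id_gaussianReal (μ := 0) (v := (σ ^ 2).toNNReal)
  rw [variance_of_integral_eq_zero aemeasurable_id' (by simp)] at h
  simpa [Real.coe_toNNReal _ (sq_nonneg σ)] using h

section OneObservation

variable {μ : Measure 𝒳}

theorem IsBoundedDesign.memLp_inner_score (h : IsBoundedDesign φ C μ)
    (v β : EuclideanSpace ℝ ι) :
    MemLp (fun z => inner ℝ v (score φ β z)) 2 (linObsLaw φ σ μ β) := by
  have hm := measurable_linObs h.measurable β
  have hs : Measurable fun z => inner ℝ v (score φ β z) :=
    measurable_const.inner (measurable_score h.measurable β)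
  rw [linObsLaw, memLp_map_measure_iff hs.aestronglyMeasurable hm.aemeasurable]
  refine (memLp_two_iff_integrable_sq (hs.comp hm).aestronglyMeasurable).2 ?_
  have := (h.memLp v).integrable_sq.mul_prod
    (memLp_id_gaussianReal (μ := 0) (v := (σ ^ 2).toNNReal) 2).integrable_sq
  refine this.congr (ae_of_all _ fun p => ?_)
  simp only [Function.comp_apply, inner_score_linObs, id_eq, mul_pow]

theorem IsBoundedDesign.integrable_norm_sq_score (h : IsBoundedDesign φ C μ)
    (β : EuclideanSpace ℝ ι) :
    Integrable (fun z => ‖score φ β z‖ ^ 2) (linObsLaw φ σ μ β) := by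
  classical
  simp only [sum_sq_inner_single]
  exact integrable_finsetSum _ fun k _ => (h.memLp_inner_score _ β).integrable_sq

variable [IsProbabilityMeasure μ]

theorem IsBoundedDesign.integral_inner_score (h : IsBoundedDesign φ C μ)
    (v β : EuclideanSpace ℝ ι) :
    ∫ z, inner ℝ v (score φ β z) ∂(linObsLaw φ σ μ β) = 0 := by
  have hs : Measurable fun z => inner ℝ v (score φ β z) :=
    measurable_const.inner (measurable_score h.measurable β)
  rw [linObsLaw, integral_map (measurable_linObs h.measurable β).aemeasurable
    hs.aestronglyMeasurable]
  simp only [inner_score_linObs]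
  rw [integral_prod_mul (fun x => inner ℝ (φ x) v) (fun ξ : ℝ => ξ)]
  simp

theorem IsBoundedDesign.integral_sq_inner_score_le (h : IsBoundedDesign φ C μ)
    (v β : EuclideanSpace ℝ ι) :
    ∫ z, inner ℝ v (score φ β z) ^ 2 ∂(linObsLaw φ σ μ β) ≤ σ ^ 2 * C * ‖v‖ ^ 2 := by
  have hs : Measurable fun z => inner ℝ v (score φ β z) ^ 2 :=
    (measurable_const.inner (measurable_score h.measurable β)).pow_const 2
  rw [linObsLaw, integral_map (measurable_linObs h.measurable β).aemeasurable
    hs.aestronglyMeasurable]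
  simp only [inner_score_linObs, mul_pow]
  rw [integral_prod_mul (fun x => inner ℝ (φ x) v ^ 2) (fun ξ : ℝ => ξ ^ 2),
    integral_sq_gaussianReal]
  nlinarith [h.integral_sq_le v, sq_nonneg σ]

theorem IsBoundedDesign.integral_norm_sq_score_le (h : IsBoundedDesign φ C μ)
    (β : EuclideanSpace ℝ ι) :
    ∫ z, ‖score φ β z‖ ^ 2 ∂(linObsLaw φ σ μ β) ≤ σ ^ 2 * C * Fintype.card ι := by
  classical
  simp only [sum_sq_inner_single]
  rw [integral_finsetSum _ fun k _ => (h.memLp_inner_score _ β).integrable_sq]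
  refine (Finset.sum_le_sum fun k _ => h.integral_sq_inner_score_le _ β).trans ?_
  simp [mul_comm]

theorem IsBoundedDesign.integrable_norm_score (h : IsBoundedDesign φ C μ)
    (β : EuclideanSpace ℝ ι) :
    Integrable (fun z => ‖score φ β z‖) (linObsLaw φ σ μ β) := by
  have := isProbabilityMeasure_linObsLaw (σ := σ) h.measurable μ β
  have h2 := h.integrable_norm_sq_score (σ := σ) β
  refine ((memLp_two_iff_integrable_sq ?_).2 h2).integrable one_le_two
  exact (measurable_score h.measurable β).norm.aestronglyMeasurable

theorem IsBoundedDesign.integral_abs_inner_score_le (h : IsBoundedDesign φ C μ)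
    (v β : EuclideanSpace ℝ ι) (hσ : 0 < σ) {t : ℝ} (ht : 0 < t) :
    ∫ z, |inner ℝ v (score φ β z)| ∂(linObsLaw φ σ μ β) ≤
      t * C * ‖v‖ ^ 2 / 2 + σ ^ 2 / (2 * t) := by
  have := isProbabilityMeasure_linObsLaw (σ := σ) h.measurable μ β
  have h2 := (h.memLp_inner_score (σ := σ) v β).integrable_sq
  calc ∫ z, |inner ℝ v (score φ β z)| ∂(linObsLaw φ σ μ β)
      ≤ ∫ z, (t / (2 * σ ^ 2) * inner ℝ v (score φ β z) ^ 2 + σ ^ 2 / (2 * t))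
          ∂(linObsLaw φ σ μ β) := by
        refine integral_mono_of_nonneg (ae_of_all _ fun z => abs_nonneg _)
          ((h2.const_mul _).add (integrable_const _)) (ae_of_all _ fun z => ?_)
        set s := inner ℝ v (score φ β z)
        have e : t / (2 * σ ^ 2) * s ^ 2 + σ ^ 2 / (2 * t) - |s|
            = (t * |s| - σ ^ 2) ^ 2 / (2 * t * σ ^ 2) := by
          rw [← sq_abs s]; field_simp; ring
        have : 0 ≤ (t * |s| - σ ^ 2) ^ 2 / (2 * t * σ ^ 2) := by positivity
        show |s| ≤ _
        linarith
    _ = t / (2 * σ ^ 2) * ∫ z, inner ℝ v (score φ β z) ^ 2 ∂(linObsLaw φ σ μ β)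
          + σ ^ 2 / (2 * t) := by
        rw [integral_add (h2.const_mul _) (integrable_const _), integral_const_mul]
        simp
    _ ≤ t / (2 * σ ^ 2) * (σ ^ 2 * C * ‖v‖ ^ 2) + σ ^ 2 / (2 * t) := by
        have := h.integral_sq_inner_score_le (σ := σ) v β
        gcongr
    _ = _ := by field_simp

theorem IsBoundedDesign.integral_norm_score_le [Nonempty ι] (h : IsBoundedDesign φ C μ)
    (β : EuclideanSpace ℝ ι) (hσ : 0 < σ) :
    ∫ z, ‖score φ β z‖ ∂(linObsLaw φ σ μ β) ≤ σ * (C + 1) * Fintype.card ι / 2 := by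
  have := isProbabilityMeasure_linObsLaw (σ := σ) h.measurable μ β
  have h2 := h.integrable_norm_sq_score (σ := σ) β
  have hp : (1 : ℝ) ≤ Fintype.card ι := by exact_mod_cast Fintype.card_pos
  calc ∫ z, ‖score φ β z‖ ∂(linObsLaw φ σ μ β)
      ≤ ∫ z, (1 / (2 * σ) * ‖score φ β z‖ ^ 2 + σ / 2) ∂(linObsLaw φ σ μ β) := by
        refine integral_mono_of_nonneg (ae_of_all _ fun z => norm_nonneg _)
          ((h2.const_mul _).add (integrable_const _)) (ae_of_all _ fun z => ?_)
        set s := ‖score φ β z‖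
        have e : 1 / (2 * σ) * s ^ 2 + σ / 2 - s = (s - σ) ^ 2 / (2 * σ) := by
          field_simp; ring
        have : 0 ≤ (s - σ) ^ 2 / (2 * σ) := by positivity
        show s ≤ _
        linarith
    _ = 1 / (2 * σ) * ∫ z, ‖score φ β z‖ ^ 2 ∂(linObsLaw φ σ μ β) + σ / 2 := by
        rw [integral_add (h2.const_mul _) (integrable_const _), integral_const_mul]
        simp
    _ ≤ 1 / (2 * σ) * (σ ^ 2 * C * Fintype.card ι) + σ / 2 := by
        have := h.integral_norm_sq_score_le (σ := σ) β
        gcongr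
    _ = σ * C * Fintype.card ι / 2 + σ * 1 / 2 := by field_simp
    _ ≤ σ * C * Fintype.card ι / 2 + σ * Fintype.card ι / 2 := by gcongr
    _ = _ := by ring

end OneObservation

section Sample

variable {μ : Fin n → Measure 𝒳} [∀ i, IsProbabilityMeasure (μ i)]

/-- The law of a sample of size `n` from the linear regression model. -/
def linSampleLaw (φ : 𝒳 → EuclideanSpace ℝ ι) (σ : ℝ) (μ : Fin n → Measure 𝒳)
    (β : EuclideanSpace ℝ ι) : Measure (Fin n → 𝒳 × ℝ) :=
  Measure.pi fun i => linObsLaw φ σ (μ i) β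

theorem measurable_totalScore (hφ : Measurable φ) (β : EuclideanSpace ℝ ι) :
    Measurable (totalScore φ β : (Fin n → 𝒳 × ℝ) → _) :=
  Finset.measurable_sum _ fun i _ => (measurable_score hφ β).comp (measurable_pi_apply i)

theorem isProbabilityMeasure_linSampleLaw (hφ : Measurable φ) (β : EuclideanSpace ℝ ι) :
    IsProbabilityMeasure (linSampleLaw φ σ μ β) := by
  have := fun i => isProbabilityMeasure_linObsLaw (σ := σ) hφ (μ i) β
  unfold linSampleLaw
  infer_instance

theorem memLp_inner_totalScore (hμ : ∀ i, IsBoundedDesign φ C (μ i)) (hφ : Measurable φ)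
    (v β : EuclideanSpace ℝ ι) :
    MemLp (fun Z => inner ℝ v (totalScore φ β Z)) 2 (linSampleLaw φ σ μ β) := by
  have := fun i => isProbabilityMeasure_linObsLaw (σ := σ) hφ (μ i) β
  simp only [totalScore, inner_sum]
  refine memLp_finsetSum _ fun i _ => ?_
  exact ((hμ i).memLp_inner_score v β).comp_measurePreserving
    (measurePreserving_eval (fun i => linObsLaw φ σ (μ i) β) i)

theorem integral_inner_totalScore (hμ : ∀ i, IsBoundedDesign φ C (μ i)) (hφ : Measurable φ)
    (v β : EuclideanSpace ℝ ι) :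
    ∫ Z, inner ℝ v (totalScore φ β Z) ∂(linSampleLaw φ σ μ β) = 0 := by
  have := fun i => isProbabilityMeasure_linObsLaw (σ := σ) hφ (μ i) β
  simp only [totalScore, inner_sum, linSampleLaw]
  rw [integral_finsetSum]
  · refine Finset.sum_eq_zero fun i _ => ?_
    rw [integral_comp_eval (μ := fun i => linObsLaw φ σ (μ i) β)
      (f := fun z => inner ℝ v (score φ β z)), (hμ i).integral_inner_score]
    exact ((hμ i).memLp_inner_score v β).aestronglyMeasurable
  · intro i _
    exact integrable_comp_eval (μ := fun i => linObsLaw φ σ (μ i) β)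
      (f := fun z => inner ℝ v (score φ β z))
      (((hμ i).memLp_inner_score v β).integrable one_le_two)

theorem integral_sq_inner_totalScore_le (hμ : ∀ i, IsBoundedDesign φ C (μ i)) (hφ : Measurable φ)
    (v β : EuclideanSpace ℝ ι) :
    ∫ Z, inner ℝ v (totalScore φ β Z) ^ 2 ∂(linSampleLaw φ σ μ β) ≤
      n * (σ ^ 2 * C * ‖v‖ ^ 2) := by
  have := fun i => isProbabilityMeasure_linObsLaw (σ := σ) hφ (μ i) β
  have hv := variance_sum_pi (μ := fun i => linObsLaw φ σ (μ i) β)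
    (X := fun _ z => inner ℝ v (score φ β z)) fun i => (hμ i).memLp_inner_score v β
  have hsum : (∑ i, fun Z : Fin n → 𝒳 × ℝ => inner ℝ v (score φ β (Z i))) =
      fun Z => inner ℝ v (totalScore φ β Z) := by
    ext Z; simp [totalScore, inner_sum]
  change Var[_; linSampleLaw φ σ μ β] = _ at hv
  rw [hsum, variance_of_integral_eq_zero
    (memLp_inner_totalScore (σ := σ) hμ hφ v β).aestronglyMeasurable.aemeasurable
    (integral_inner_totalScore hμ hφ v β)] at hv
  refine hv.le.trans ?_
  calc ∑ i, Var[fun z => inner ℝ v (score φ β z); linObsLaw φ σ (μ i) β]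
      ≤ ∑ _i : Fin n, σ ^ 2 * C * ‖v‖ ^ 2 := by
        refine Finset.sum_le_sum fun i _ => ?_
        rw [variance_of_integral_eq_zero
          ((hμ i).memLp_inner_score v β).aestronglyMeasurable.aemeasurable
          ((hμ i).integral_inner_score v β)]
        exact (hμ i).integral_sq_inner_score_le v β
    _ = _ := by simp

theorem integrable_norm_sq_totalScore (hμ : ∀ i, IsBoundedDesign φ C (μ i)) (hφ : Measurable φ)
    (β : EuclideanSpace ℝ ι) :
    Integrable (fun Z => ‖totalScore φ β Z‖ ^ 2) (linSampleLaw φ σ μ β) := by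
  classical
  simp only [sum_sq_inner_single]
  exact integrable_finsetSum _ fun k _ => (memLp_inner_totalScore hμ hφ _ β).integrable_sq

theorem integral_norm_sq_totalScore_le (hμ : ∀ i, IsBoundedDesign φ C (μ i)) (hφ : Measurable φ)
    (β : EuclideanSpace ℝ ι) :
    ∫ Z, ‖totalScore φ β Z‖ ^ 2 ∂(linSampleLaw φ σ μ β) ≤
      n * (σ ^ 2 * C * Fintype.card ι) := by
  classical
  simp only [sum_sq_inner_single]
  rw [integral_finsetSum _ fun k _ => (memLp_inner_totalScore hμ hφ _ β).integrable_sq]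
  refine (Finset.sum_le_sum fun k _ => integral_sq_inner_totalScore_le hμ hφ _ β).trans ?_
  simp only [PiLp.norm_single, norm_one, one_pow, mul_one, Finset.sum_const,
    Finset.card_univ, nsmul_eq_mul]
  exact le_of_eq (by ring)

theorem integrable_norm_totalScore (hμ : ∀ i, IsBoundedDesign φ C (μ i)) (hφ : Measurable φ)
    (β : EuclideanSpace ℝ ι) :
    Integrable (fun Z => ‖totalScore φ β Z‖) (linSampleLaw φ σ μ β) := by
  have := isProbabilityMeasure_linSampleLaw (σ := σ) (μ := μ) hφ β
  refine ((memLp_two_iff_integrable_sq ?_).2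
    (integrable_norm_sq_totalScore hμ hφ β)).integrable one_le_two
  exact (measurable_totalScore hφ β).norm.aestronglyMeasurable

theorem measurePreserving_linData (hφ : Measurable φ) (β : EuclideanSpace ℝ ι) :
    MeasurePreserving (linData φ σ β)
      ((Measure.pi μ).prod (Measure.pi fun _ : Fin n => gaussianReal 0 1))
      (linSampleLaw φ σ μ β) := by
  have hpr := fun i => isProbabilityMeasure_linObsLaw (σ := σ) hφ (μ i) β
  have h1 := measurePreserving_arrowProdEquivProdArrow 𝒳 ℝ (Fin n) μ
    (fun _ => gaussianReal 0 1)
  have hg : MeasurePreserving (fun x : ℝ => σ * x) (gaussianReal 0 1)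
      (gaussianReal 0 (σ ^ 2).toNNReal) := by
    refine ⟨by fun_prop, ?_⟩
    rw [gaussianReal_map_const_mul]
    congr 1
    · simp
    · ext; simp [Real.coe_toNNReal _ (sq_nonneg σ)]
  have h2 : MeasurePreserving
      (fun (a : Fin n → 𝒳 × ℝ) i => ((a i).1, inner ℝ (φ (a i).1) β + σ * (a i).2))
      (Measure.pi fun i => (μ i).prod (gaussianReal 0 1)) (linSampleLaw φ σ μ β) := by
    refine measurePreserving_pi _ (fun i => linObsLaw φ σ (μ i) β)
      (f := fun _ (z : 𝒳 × ℝ) => (z.1, inner ℝ (φ z.1) β + σ * z.2)) fun i => ?_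
    have h3 : MeasurePreserving (fun p : 𝒳 × ℝ => (p.1, inner ℝ (φ p.1) β + p.2))
        ((μ i).prod (gaussianReal 0 (σ ^ 2).toNNReal)) (linObsLaw φ σ (μ i) β) :=
      ⟨measurable_linObs hφ β, rfl⟩
    exact h3.comp ((MeasurePreserving.id (μ i)).prod hg)
  exact h2.comp h1.symm

end Sample

end Model

/-! ### Upper bounds on the correlation of an estimator with the score -/

section Attack

variable {ι 𝒳 Θ : Type*} [Fintype ι] {T : Θ → EuclideanSpace ℝ ι} {R : ℝ}

theorem abs_inner_sub_le (hTR : ∀ θ, ‖T θ‖ ≤ R) (θ : Θ) (β w : EuclideanSpace ℝ ι) :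
    |inner ℝ (T θ - β) w| ≤ (R + ‖β‖) * ‖w‖ := by
  refine (abs_real_inner_le_norm _ _).trans ?_
  gcongr
  exact (norm_sub_le _ _).trans (add_le_add_left (hTR θ) _)

theorem norm_sub_sq_le (hTR : ∀ θ, ‖T θ‖ ≤ R) (θ : Θ) (β : EuclideanSpace ℝ ι) :
    ‖T θ - β‖ ^ 2 ≤ (R + ‖β‖) ^ 2 := by
  gcongr
  exact (norm_sub_le _ _).trans (add_le_add_left (hTR θ) _)

variable [MeasurableSpace 𝒳] [MeasurableSpace Θ] {n : ℕ}
variable {φ : 𝒳 → EuclideanSpace ℝ ι} {σ C : ℝ} {μ : Fin n → Measure 𝒳}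
  {A : Kernel (Fin n → 𝒳 × ℝ) Θ}

/-- The expected correlation `E ⟨T θ - β, ∑ᵢ scoreᵢ⟩` between the error of the estimator `T θ`, for
an output `θ` of the algorithm `A`, and the score of the sample. -/
def correlation (φ : 𝒳 → EuclideanSpace ℝ ι) (σ : ℝ) (μ : Fin n → Measure 𝒳)
    (A : Kernel (Fin n → 𝒳 × ℝ) Θ) (T : Θ → EuclideanSpace ℝ ι) (β : EuclideanSpace ℝ ι) : ℝ :=
  ∫ Z, ∫ θ, inner ℝ (T θ - β) (totalScore φ β Z) ∂(A Z) ∂(linSampleLaw φ σ μ β)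

/-- The mean squared error `E ‖T θ - β‖²`, as a real number; it is only used for bounded `T`. -/
def meanSqErr (φ : 𝒳 → EuclideanSpace ℝ ι) (σ : ℝ) (μ : Fin n → Measure 𝒳)
    (A : Kernel (Fin n → 𝒳 × ℝ) Θ) (T : Θ → EuclideanSpace ℝ ι) (β : EuclideanSpace ℝ ι) : ℝ :=
  ∫ Z, ∫ θ, ‖T θ - β‖ ^ 2 ∂(A Z) ∂(linSampleLaw φ σ μ β)

variable [∀ i, IsProbabilityMeasure (μ i)] [IsMarkovKernel A]

theorem integrable_integral_norm_sub_sq (hφ : Measurable φ) (hT : Measurable T)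
    (hTR : ∀ θ, ‖T θ‖ ≤ R) (β : EuclideanSpace ℝ ι) :
    Integrable (fun Z => ∫ θ, ‖T θ - β‖ ^ 2 ∂(A Z)) (linSampleLaw φ σ μ β) := by
  have := isProbabilityMeasure_linSampleLaw (σ := σ) (μ := μ) hφ β
  refine integrable_integral_kernel (G := fun q => ‖T q.2 - β‖ ^ 2) (by fun_prop)
    (integrable_const ((R + ‖β‖) ^ 2)) fun Z θ => ?_
  rw [abs_of_nonneg (by positivity)]
  exact norm_sub_sq_le hTR θ β

theorem integrable_norm_sub_sq (hT : Measurable T) (hTR : ∀ θ, ‖T θ‖ ≤ R)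
    (β : EuclideanSpace ℝ ι) (ν : Measure Θ) [IsProbabilityMeasure ν] :
    Integrable (fun θ => ‖T θ - β‖ ^ 2) ν := by
  refine Integrable.of_bound (by fun_prop) ((R + ‖β‖) ^ 2) (ae_of_all _ fun θ => ?_)
  rw [Real.norm_of_nonneg (by positivity)]
  exact norm_sub_sq_le hTR θ β

theorem integrable_inner_sub (hT : Measurable T) (hTR : ∀ θ, ‖T θ‖ ≤ R)
    (β w : EuclideanSpace ℝ ι) (ν : Measure Θ) [IsProbabilityMeasure ν] :
    Integrable (fun θ => inner ℝ (T θ - β) w) ν :=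
  Integrable.of_bound (by fun_prop) ((R + ‖β‖) * ‖w‖)
    (ae_of_all _ fun θ => abs_inner_sub_le hTR θ β w)

theorem integrable_integral_inner_totalScore (hμ : ∀ i, IsBoundedDesign φ C (μ i))
    (hφ : Measurable φ) (hT : Measurable T) (hTR : ∀ θ, ‖T θ‖ ≤ R) (β : EuclideanSpace ℝ ι) :
    Integrable (fun Z => ∫ θ, inner ℝ (T θ - β) (totalScore φ β Z) ∂(A Z))
      (linSampleLaw φ σ μ β) := by
  have hs := measurable_totalScore (n := n) hφ β
  exact integrable_integral_kernel
    (G := fun q : (Fin n → 𝒳 × ℝ) × Θ => inner ℝ (T q.2 - β) (totalScore φ β q.1))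
    (by fun_prop) ((integrable_norm_totalScore hμ hφ β).const_mul (R + ‖β‖))
    fun Z θ => abs_inner_sub_le hTR θ β _

/-- Without privacy, the correlation is at most what the Cauchy–Schwarz inequality gives, here in
the form `u v ≤ t u² / 2 + v² / (2 t)`, which stays affine in the mean squared error. -/
theorem correlation_le (hμ : ∀ i, IsBoundedDesign φ C (μ i))
    (hφ : Measurable φ) (hT : Measurable T) (hTR : ∀ θ, ‖T θ‖ ≤ R) (β : EuclideanSpace ℝ ι)
    {t : ℝ} (ht : 0 < t) :
    correlation φ σ μ A T β ≤
      t / 2 * meanSqErr φ σ μ A T β + n * (σ ^ 2 * C * Fintype.card ι) / (2 * t) := by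
  have h1 := integrable_integral_norm_sub_sq (A := A) (σ := σ) (μ := μ) hφ hT hTR β
  have h2 := integrable_norm_sq_totalScore (σ := σ) hμ hφ β
  calc correlation φ σ μ A T β
      ≤ ∫ Z, (t / 2 * ∫ θ, ‖T θ - β‖ ^ 2 ∂(A Z) + 1 / (2 * t) * ‖totalScore φ β Z‖ ^ 2)
          ∂(linSampleLaw φ σ μ β) := by
        refine integral_mono (integrable_integral_inner_totalScore hμ hφ hT hTR β)
          ((h1.const_mul _).add (h2.const_mul _)) fun Z => ?_
        have h3 := integrable_norm_sub_sq hT hTR β (A Z)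
        have h4 : ∫ θ, inner ℝ (T θ - β) (totalScore φ β Z) ∂(A Z) ≤
            ∫ θ, (t / 2 * ‖T θ - β‖ ^ 2 + 1 / (2 * t) * ‖totalScore φ β Z‖ ^ 2) ∂(A Z) := by
          refine integral_mono (integrable_inner_sub hT hTR β _ _)
            ((h3.const_mul _).add (integrable_const _)) fun θ => ?_
          set a := ‖T θ - β‖
          set b := ‖totalScore φ β Z‖
          have e : t / 2 * a ^ 2 + 1 / (2 * t) * b ^ 2 - a * b = (t * a - b) ^ 2 / (2 * t) := by
            field_simp; ring
          have : 0 ≤ (t * a - b) ^ 2 / (2 * t) := by positivity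
          exact (real_inner_le_norm _ _).trans (by linarith)
        refine h4.trans (le_of_eq ?_)
        rw [integral_add (h3.const_mul _) (integrable_const _), integral_const_mul]
        simp
    _ = t / 2 * meanSqErr φ σ μ A T β
          + 1 / (2 * t) * ∫ Z, ‖totalScore φ β Z‖ ^ 2 ∂(linSampleLaw φ σ μ β) := by
        rw [integral_add (h1.const_mul _) (h2.const_mul _), integral_const_mul,
          integral_const_mul, meanSqErr]
    _ ≤ t / 2 * meanSqErr φ σ μ A T β + 1 / (2 * t) * (n * (σ ^ 2 * C * Fintype.card ι)) := by
        have := integral_norm_sq_totalScore_le (σ := σ) hμ hφ β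
        gcongr
    _ = _ := by ring

/-- Under privacy each of the `n` observations contributes to the correlation at most about `ε`
times the typical size of a single term, plus a term in `δ`, for which the pointwise bound `R` on
the estimator is needed. -/
theorem correlation_le_of_private [Nonempty ι] (hμ : ∀ i, IsBoundedDesign φ C (μ i))
    (hφ : Measurable φ) (hT : Measurable T) (hTR : ∀ θ, ‖T θ‖ ≤ R) (β : EuclideanSpace ℝ ι)
    (hσ : 0 < σ) (hC : 0 ≤ C) (hR : 0 ≤ R) {ε δ t : ℝ} (hε : 0 ≤ ε) (hδ : 0 ≤ δ) (ht : 0 < t)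
    (hA : ∀ i, ∀ Z Z' : Fin n → 𝒳 × ℝ, (∀ j, j ≠ i → Z j = Z' j) → ∀ Q, MeasurableSet Q →
      A Z Q ≤ ENNReal.ofReal (Real.exp ε) * A Z' Q + ENNReal.ofReal δ) :
    correlation φ σ μ A T β ≤
      n * ((Real.exp ε - 1) * (t * C / 2 * meanSqErr φ σ μ A T β + σ ^ 2 / (2 * t))
        + 2 * δ * ((R + ‖β‖) * (σ * (C + 1) * Fintype.card ι / 2))) := by
  have hpr := fun i => isProbabilityMeasure_linObsLaw (σ := σ) hφ (μ i) β
  have hpr' := isProbabilityMeasure_linSampleLaw (σ := σ) (μ := μ) hφ β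
  have hs := measurable_score hφ β
  have hev : ∀ i, Integrable (fun Z : Fin n → 𝒳 × ℝ => ‖score φ β (Z i)‖)
      (linSampleLaw φ σ μ β) := fun i =>
    integrable_comp_eval (μ := fun i => linObsLaw φ σ (μ i) β)
      (f := fun z => ‖score φ β z‖) ((hμ i).integrable_norm_score β)
  have hsum : correlation φ σ μ A T β =
      ∑ i, ∫ Z, ∫ θ, inner ℝ (T θ - β) (score φ β (Z i)) ∂(A Z) ∂(linSampleLaw φ σ μ β) := by
    rw [← integral_finsetSum]
    · refine integral_congr_ae (ae_of_all _ fun Z => ?_)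
      simp only [totalScore, inner_sum]
      exact integral_finsetSum _ fun i _ => integrable_inner_sub hT hTR β _ _
    · intro i _
      exact integrable_integral_kernel
        (G := fun q : (Fin n → 𝒳 × ℝ) × Θ => inner ℝ (T q.2 - β) (score φ β (q.1 i)))
        (by fun_prop) ((hev i).const_mul (R + ‖β‖)) fun Z θ => abs_inner_sub_le hTR θ β _
  have hone : ∀ i : Fin n,
      ∫ Z, ∫ θ, inner ℝ (T θ - β) (score φ β (Z i)) ∂(A Z) ∂(linSampleLaw φ σ μ β) ≤
      (Real.exp ε - 1) * (t * C / 2 * meanSqErr φ σ μ A T β + σ ^ 2 / (2 * t))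
        + 2 * δ * ((R + ‖β‖) * (σ * (C + 1) * Fintype.card ι / 2)) := by
    intro i
    let K : Θ → ℝ := fun θ => t * C / 2 * ‖T θ - β‖ ^ 2 + σ ^ 2 / (2 * t)
    let G : Θ × (𝒳 × ℝ) → ℝ := fun q => inner ℝ (T q.1 - β) (score φ β q.2)
    have hKm : Measurable K := by fun_prop
    have hGm : Measurable G := by fun_prop
    have hKb : ∀ θ, |K θ| ≤ t * C / 2 * (R + ‖β‖) ^ 2 + σ ^ 2 / (2 * t) := fun θ => by
      have h0 : 0 ≤ K θ := by positivity
      rw [abs_of_nonneg h0]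
      exact add_le_add_left (mul_le_mul_of_nonneg_left (norm_sub_sq_le hTR θ β)
        (by positivity)) _
    have hGK : ∀ θ, ∫ z, |G (θ, z)| ∂(linObsLaw φ σ (μ i) β) ≤ K θ := fun θ =>
      ((hμ i).integral_abs_inner_score_le (T θ - β) β hσ ht).trans
        (le_of_eq (by simp only [K]; ring))
    have key := integral_kernel_eval_le_of_private
      (P := fun i => linObsLaw φ σ (μ i) β) (A := A) hε hδ i (hA i) hGm
      (b := fun z => (R + ‖β‖) * ‖score φ β z‖)
      (((hμ i).integrable_norm_score β).const_mul _)
      (fun θ z => abs_inner_sub_le hTR θ β _)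
      (fun θ => (hμ i).integral_inner_score (T θ - β) β) hKm hKb hGK
    refine key.trans ?_
    have h1 := integrable_integral_norm_sub_sq (A := A) (σ := σ) (μ := μ) hφ hT hTR β
    have hK : ∫ Z, ∫ θ, (t * C / 2 * ‖T θ - β‖ ^ 2 + σ ^ 2 / (2 * t)) ∂(A Z)
        ∂(linSampleLaw φ σ μ β) = t * C / 2 * meanSqErr φ σ μ A T β + σ ^ 2 / (2 * t) := by
      have : ∀ Z, ∫ θ, (t * C / 2 * ‖T θ - β‖ ^ 2 + σ ^ 2 / (2 * t)) ∂(A Z) =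
          t * C / 2 * ∫ θ, ‖T θ - β‖ ^ 2 ∂(A Z) + σ ^ 2 / (2 * t) := fun Z => by
        rw [integral_add ((integrable_norm_sub_sq hT hTR β _).const_mul _) (integrable_const _),
          integral_const_mul]
        simp
      simp only [this]
      rw [integral_add (h1.const_mul _) (integrable_const _), integral_const_mul, meanSqErr]
      simp
    refine add_le_add (le_of_eq (congrArg _ hK)) ?_
    rw [integral_const_mul]
    have := (hμ i).integral_norm_score_le β hσ
    gcongr
  rw [hsum]
  refine (Finset.sum_le_sum fun i _ => hone i).trans (le_of_eq ?_)
  rw [Finset.sum_const, Finset.card_univ, Fintype.card_fin, nsmul_eq_mul]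

end Attack

/-! ### The Gaussian prior -/

section Prior

variable {ι : Type*}

/-- The parameter `β = a g` obtained from a standard vector `g`; under `stdPrior` it has the
distribution `N(0, a² I)`. -/
def scaled (a : ℝ) (g : ι → ℝ) : EuclideanSpace ℝ ι := WithLp.toLp 2 (a • g)

theorem measurable_scaled (a : ℝ) : Measurable (scaled a : (ι → ℝ) → EuclideanSpace ℝ ι) := by
  unfold scaled; fun_prop

variable [Fintype ι]

/-- The standard Gaussian distribution of a vector of independent coordinates. -/
def stdPrior (ι : Type*) [Fintype ι] : Measure (ι → ℝ) := Measure.pi fun _ => gaussianReal 0 1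

instance : IsProbabilityMeasure (stdPrior ι) := by unfold stdPrior; infer_instance

theorem norm_sq_scaled (a : ℝ) (g : ι → ℝ) : ‖scaled a g‖ ^ 2 = a ^ 2 * ∑ k, g k ^ 2 := by
  rw [EuclideanSpace.real_norm_sq_eq, Finset.mul_sum]
  simp [scaled, mul_pow]

theorem integrable_sq_stdPrior (k : ι) : Integrable (fun g => g k ^ 2) (stdPrior ι) :=
  integrable_comp_eval (μ := fun _ : ι => gaussianReal 0 1) (f := fun x : ℝ => x ^ 2)
    (memLp_id_gaussianReal (μ := 0) (v := 1) 2).integrable_sq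

theorem integrable_norm_sq_scaled (a : ℝ) :
    Integrable (fun g => ‖scaled a g‖ ^ 2) (stdPrior ι) := by
  simp only [norm_sq_scaled]
  exact (integrable_finsetSum _ fun k _ => integrable_sq_stdPrior k).const_mul _

theorem integral_norm_sq_scaled (a : ℝ) :
    ∫ g, ‖scaled a g‖ ^ 2 ∂(stdPrior ι) = a ^ 2 * Fintype.card ι := by
  simp only [norm_sq_scaled]
  rw [integral_const_mul, integral_finsetSum _ fun k _ => integrable_sq_stdPrior k]
  have : ∀ k : ι, ∫ g, g k ^ 2 ∂(stdPrior ι) = 1 := fun k => by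
    rw [stdPrior, integral_comp_eval (μ := fun _ : ι => gaussianReal 0 1)
      (f := fun x : ℝ => x ^ 2) (by fun_prop)]
    simpa using integral_sq_gaussianReal 1
  simp [this]

/-- The fourth moment of the standard Gaussian distribution. -/
def gaussianFourthMoment : ℝ := ∫ x, x ^ 4 ∂(gaussianReal 0 1)

theorem integrable_pow_four_gaussianReal : Integrable (fun x : ℝ => x ^ 4) (gaussianReal 0 1) := by
  have := (memLp_id_gaussianReal (μ := 0) (v := 1) 4).integrable_norm_pow (p := 4) (by norm_num)
  simpa [Real.norm_eq_abs, Even.pow_abs (by decide : Even 4)] using this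

theorem integrable_pow_four_stdPrior (k : ι) : Integrable (fun g => g k ^ 4) (stdPrior ι) :=
  integrable_comp_eval (μ := fun _ : ι => gaussianReal 0 1) (f := fun x : ℝ => x ^ 4)
    integrable_pow_four_gaussianReal

theorem norm_pow_four_scaled_le (a : ℝ) (g : ι → ℝ) :
    ‖scaled a g‖ ^ 4 ≤ a ^ 4 * (Fintype.card ι * ∑ k, g k ^ 4) := by
  have h : ‖scaled a g‖ ^ 4 = a ^ 4 * (∑ k, g k ^ 2) ^ 2 := by
    rw [show ‖scaled a g‖ ^ 4 = (‖scaled a g‖ ^ 2) ^ 2 by ring, norm_sq_scaled]; ring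
  rw [h]
  have := sq_sum_le_card_mul_sum_sq (s := Finset.univ) (f := fun k => g k ^ 2)
  simp only [← pow_mul, Finset.card_univ] at this
  gcongr

theorem integrable_norm_pow_four_scaled (a : ℝ) :
    Integrable (fun g => ‖scaled a g‖ ^ 4) (stdPrior ι) := by
  refine Integrable.mono' (((integrable_finsetSum Finset.univ fun k _ =>
    integrable_pow_four_stdPrior k).const_mul (Fintype.card ι : ℝ)).const_mul (a ^ 4))
    ((measurable_scaled a).norm.pow_const 4).aestronglyMeasurable (ae_of_all _ fun g => ?_)
  rw [Real.norm_of_nonneg (by positivity)]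
  exact norm_pow_four_scaled_le a g

theorem integral_norm_pow_four_scaled_le (a : ℝ) :
    ∫ g, ‖scaled a g‖ ^ 4 ∂(stdPrior ι) ≤
      gaussianFourthMoment * (a ^ 2 * Fintype.card ι) ^ 2 := by
  have hi := ((integrable_finsetSum Finset.univ fun (k : ι) _ =>
    integrable_pow_four_stdPrior k).const_mul (Fintype.card ι : ℝ)).const_mul (a ^ 4)
  refine (integral_mono (integrable_norm_pow_four_scaled a) hi
    (norm_pow_four_scaled_le a)).trans (le_of_eq ?_)
  rw [integral_const_mul, integral_const_mul,
    integral_finsetSum _ fun k _ => integrable_pow_four_stdPrior k]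
  have : ∀ k : ι, ∫ g, g k ^ 4 ∂(stdPrior ι) = gaussianFourthMoment := fun k => by
    rw [stdPrior, integral_comp_eval (μ := fun _ : ι => gaussianReal 0 1)
      (f := fun x : ℝ => x ^ 4) (by fun_prop), gaussianFourthMoment]
  simp [this]
  ring

theorem ae_scaled_ne_zero [Nonempty ι] {a : ℝ} (ha : a ≠ 0) :
    ∀ᵐ g ∂(stdPrior ι), scaled a g ≠ 0 := by
  obtain ⟨k⟩ := ‹Nonempty ι›
  have hna : NullSingletonClass (gaussianReal 0 1) := nullSingletonClass_gaussianReal one_ne_zero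
  have h0 : ∀ᵐ x ∂(gaussianReal 0 1), x ≠ 0 := by
    simp [ae_iff]
  have := (measurePreserving_eval (fun _ : ι => gaussianReal 0 1) k).quasiMeasurePreserving.ae h0
  filter_upwards [this] with g hg h
  refine hg ?_
  have := congrArg (fun v : EuclideanSpace ℝ ι => v k) h
  simpa [scaled, ha] using this

end Prior

/-! ### Lower bound on the average correlation -/

section Stein

variable {ι 𝒳 Θ : Type*} [Fintype ι] [MeasurableSpace 𝒳] {n : ℕ}
variable {φ : 𝒳 → EuclideanSpace ℝ ι} {σ : ℝ}

/-- The covariates and one standard Gaussian vector indexed by `ι ⊕ Fin n` have the joint law of an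
independent triple of prior, covariates and noise. -/
theorem measurePreserving_prior_design_noise (μ : Fin n → Measure 𝒳)
    [∀ i, IsProbabilityMeasure (μ i)] :
    MeasurePreserving
      (fun w : (Fin n → 𝒳) × (ι ⊕ Fin n → ℝ) =>
        ((fun k => w.2 (Sum.inl k)), (w.1, fun i => w.2 (Sum.inr i))))
      ((Measure.pi μ).prod (Measure.pi fun _ => gaussianReal 0 1))
      ((stdPrior ι).prod ((Measure.pi μ).prod (Measure.pi fun _ => gaussianReal 0 1))) := by
  have h1 := measurePreserving_sumPiEquivProdPi (X := fun _ : ι ⊕ Fin n => ℝ)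
    (fun _ => gaussianReal 0 1)
  have h2 := (MeasurePreserving.id (Measure.pi μ)).prod h1
  have h3 := (measurePreserving_prodAssoc (Measure.pi μ) (stdPrior ι)
    (Measure.pi fun _ : Fin n => gaussianReal 0 1)).symm
  have h4 := (Measure.measurePreserving_swap (μ := Measure.pi μ) (ν := stdPrior ι)).prod
    (MeasurePreserving.id (Measure.pi fun _ : Fin n => gaussianReal 0 1))
  have h5 := measurePreserving_prodAssoc (stdPrior ι) (Measure.pi μ)
    (Measure.pi fun _ : Fin n => gaussianReal 0 1)
  exact h5.comp (h4.comp (h3.comp h2))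

theorem integrable_eval_gaussian {κ : Type*} [Fintype κ] (k : κ) :
    Integrable (fun u : κ → ℝ => u k) (Measure.pi fun _ => gaussianReal 0 1) :=
  integrable_comp_eval (μ := fun _ : κ => gaussianReal 0 1) (f := fun x : ℝ => x)
    ((memLp_id_gaussianReal (μ := 0) (v := 1) 1).integrable le_rfl)

/-- For fixed covariates, an estimator `m` is orthogonal on average to the gradient in `β` of the
joint log-density of prior and sample, which is `totalScore / σ² - β / a²` and appears here
multiplied by `σ`. In each coordinate `k` it is a linear form `⟨v k, ·⟩` in the Gaussian vector of
prior and noise, and the sample does not change along `v k`. -/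
theorem integral_inner_posterior_score_eq_zero (x : Fin n → 𝒳) (σ : ℝ) {a : ℝ} (ha : a ≠ 0)
    {m : (Fin n → 𝒳 × ℝ) → EuclideanSpace ℝ ι} (hm : Measurable m) {R : ℝ}
    (hmR : ∀ Z, ‖m Z‖ ≤ R) (hφ : Measurable φ) :
    ∫ u : ι ⊕ Fin n → ℝ,
      inner ℝ (m (linData φ σ (scaled a fun k => u (Sum.inl k)) (x, fun i => u (Sum.inr i))))
        (∑ i, u (Sum.inr i) • φ (x i) - (σ / a ^ 2) • scaled a fun k => u (Sum.inl k))
      ∂(Measure.pi fun _ => gaussianReal 0 1) = 0 := by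
  classical
  let D : (ι ⊕ Fin n → ℝ) → Fin n → 𝒳 × ℝ := fun u =>
    linData φ σ (scaled a fun k => u (Sum.inl k)) (x, fun i => u (Sum.inr i))
  let v : ι → ι ⊕ Fin n → ℝ := fun k =>
    Sum.elim (Pi.single (M := fun _ => ℝ) k (-(σ / a)) : ι → ℝ) fun i => φ (x i) k
  have hv : ∀ (k : ι) (u : ι ⊕ Fin n → ℝ), ∑ j, v k j * u j =
      (∑ i, u (Sum.inr i) • φ (x i) - (σ / a ^ 2) • scaled a fun k => u (Sum.inl k)) k := by
    intro k u
    rw [Fintype.sum_sum_type]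
    simp only [v, Sum.elim_inl, Sum.elim_inr, Pi.single_apply, ite_mul, zero_mul,
      Finset.sum_ite_eq', Finset.mem_univ, if_true, PiLp.sub_apply, PiLp.smul_apply, scaled,
      Pi.smul_apply, smul_eq_mul, WithLp.ofLp_sum, Finset.sum_apply, WithLp.ofLp_smul]
    rw [Finset.sum_congr rfl fun i _ => mul_comm (φ (x i) k) (u (Sum.inr i))]
    field_simp
    ring
  have hD : ∀ (k : ι) (u : ι ⊕ Fin n → ℝ) (c : ℝ), D (u + c • v k) = D u := by
    intro k u c
    funext i
    refine Prod.ext rfl ?_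
    simp only [D, linData, scaled, v, PiLp.inner_apply, RCLike.inner_apply, conj_trivial,
      Pi.smul_apply, Pi.add_apply, Sum.elim_inl, Sum.elim_inr, smul_eq_mul, Pi.single_apply,
      mul_add, add_mul, Finset.sum_add_distrib, mul_ite, ite_mul, mul_zero, zero_mul,
      Finset.sum_ite_eq', Finset.mem_univ, if_true]
    field_simp
    ring
  have hDm : Measurable D := measurable_pi_iff.2 fun i => by
    have := measurable_scaled (ι := ι) a
    exact measurable_const.prodMk (by fun_prop)
  have hsum : ∀ u : ι ⊕ Fin n → ℝ,
      inner ℝ (m (D u))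
        (∑ i, u (Sum.inr i) • φ (x i) - (σ / a ^ 2) • scaled a fun k => u (Sum.inl k)) =
      ∑ k, (m (D u)) k * ∑ j, v k j * u j := by
    intro u
    simp only [hv, PiLp.inner_apply, RCLike.inner_apply, conj_trivial]
    exact Finset.sum_congr rfl fun k _ => mul_comm _ _
  change ∫ u : ι ⊕ Fin n → ℝ, inner ℝ (m (D u)) _ ∂_ = 0
  simp only [hsum]
  rw [integral_finsetSum]
  · refine Finset.sum_eq_zero fun k _ => ?_
    exact integral_mul_dot_eq_zero_of_translation_invariant (v k) (fun u => (m (D u)) k)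
      fun u c => by simp only [hD]
  · intro k _
    have hi : Integrable (fun u : ι ⊕ Fin n → ℝ => ∑ j, v k j * u j)
        (Measure.pi fun _ => gaussianReal 0 1) :=
      integrable_finsetSum _ fun j _ => (integrable_eval_gaussian j).const_mul _
    refine hi.bdd_mul (c := R) ?_ (ae_of_all _ fun u => ?_)
    · have := hm.comp hDm
      exact Measurable.aestronglyMeasurable (by fun_prop)
    · exact (PiLp.norm_apply_le _ _).trans (hmR _)

variable [MeasurableSpace Θ] {C : ℝ} {μ : Fin n → Measure 𝒳}
  {A : Kernel (Fin n → 𝒳 × ℝ) Θ} {T : Θ → EuclideanSpace ℝ ι} {R : ℝ}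

/-- The mean of the estimator `T θ` over the randomness of the algorithm on the data set `Z`. -/
def meanOutput (A : Kernel (Fin n → 𝒳 × ℝ) Θ) (T : Θ → EuclideanSpace ℝ ι)
    (Z : Fin n → 𝒳 × ℝ) : EuclideanSpace ℝ ι :=
  ∫ θ, T θ ∂(A Z)

theorem measurable_linData_scaled (hφ : Measurable φ) (σ a : ℝ) :
    Measurable fun w : (ι → ℝ) × ((Fin n → 𝒳) × (Fin n → ℝ)) =>
      linData φ σ (scaled a w.1) w.2 :=
  measurable_pi_iff.2 fun i => by
    have := measurable_scaled (ι := ι) a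
    exact Measurable.prodMk (by fun_prop) (by fun_prop)

theorem integrable_norm_scaled (a : ℝ) :
    Integrable (fun g => ‖scaled a g‖) (stdPrior ι) := by
  have h : MemLp (fun g => ‖scaled a g‖) 2 (stdPrior ι) := by
    rw [memLp_two_iff_integrable_sq (measurable_scaled a).norm.aestronglyMeasurable]
    exact integrable_norm_sq_scaled a
  exact h.integrable one_le_two

theorem measurable_meanOutput (hT : Measurable T) : Measurable (meanOutput A T) :=
  (StronglyMeasurable.integral_kernel hT.stronglyMeasurable).measurable

theorem meanSqErr_eq [∀ i, IsProbabilityMeasure (μ i)] (hφ : Measurable φ)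
    (hT : Measurable T) (β : EuclideanSpace ℝ ι) :
    meanSqErr φ σ μ A T β =
      ∫ q, ∫ θ, ‖T θ - β‖ ^ 2 ∂(A (linData φ σ β q))
        ∂((Measure.pi μ).prod (Measure.pi fun _ : Fin n => gaussianReal 0 1)) := by
  rw [meanSqErr, ← (measurePreserving_linData hφ β).map_eq,
    integral_map (measurePreserving_linData (μ := μ) hφ β).aemeasurable]
  exact (StronglyMeasurable.integral_kernel (κ := A) (f := fun θ => ‖T θ - β‖ ^ 2)
    (Measurable.stronglyMeasurable (by fun_prop))).aestronglyMeasurable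

variable [IsMarkovKernel A]

theorem norm_meanOutput_le (hTR : ∀ θ, ‖T θ‖ ≤ R) (Z : Fin n → 𝒳 × ℝ) :
    ‖meanOutput A T Z‖ ≤ R := by
  simpa [meanOutput] using norm_integral_le_of_norm_le_const (μ := A Z) (ae_of_all _ hTR)

theorem integrable_estimator (hT : Measurable T) (hTR : ∀ θ, ‖T θ‖ ≤ R) (ν : Measure Θ)
    [IsProbabilityMeasure ν] : Integrable T ν :=
  Integrable.of_bound hT.aestronglyMeasurable R (ae_of_all _ hTR)

theorem integral_inner_estimator (hT : Measurable T) (hTR : ∀ θ, ‖T θ‖ ≤ R)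
    (Z : Fin n → 𝒳 × ℝ) (w : EuclideanSpace ℝ ι) :
    ∫ θ, inner ℝ (T θ) w ∂(A Z) = inner ℝ (meanOutput A T Z) w := by
  simp only [real_inner_comm w]
  exact integral_inner (integrable_estimator hT hTR _) w

variable [∀ i, IsProbabilityMeasure (μ i)]

theorem correlation_eq (hμ : ∀ i, IsBoundedDesign φ C (μ i)) (hφ : Measurable φ)
    (hT : Measurable T) (hTR : ∀ θ, ‖T θ‖ ≤ R) (β : EuclideanSpace ℝ ι) :
    correlation φ σ μ A T β =
      ∫ q, inner ℝ (meanOutput A T (linData φ σ β q)) (∑ i, (σ * q.2 i) • φ (q.1 i))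
        ∂((Measure.pi μ).prod (Measure.pi fun _ : Fin n => gaussianReal 0 1)) := by
  have hm := measurable_meanOutput (A := A) hT
  have hs := measurable_totalScore (n := n) hφ β
  have hpr := isProbabilityMeasure_linSampleLaw (σ := σ) (μ := μ) hφ β
  have h1 : ∀ Z, ∫ θ, inner ℝ (T θ - β) (totalScore φ β Z) ∂(A Z) =
      inner ℝ (meanOutput A T Z) (totalScore φ β Z) - inner ℝ β (totalScore φ β Z) := fun Z => by
    have hi : Integrable (fun θ => inner ℝ (T θ) (totalScore φ β Z)) (A Z) := by
      simpa using integrable_inner_sub hT hTR 0 (totalScore φ β Z) (A Z)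
    simp only [inner_sub_left]
    rw [integral_sub hi (integrable_const _), integral_inner_estimator hT hTR]
    simp
  have hi : Integrable (fun Z => inner ℝ (meanOutput A T Z) (totalScore φ β Z))
      (linSampleLaw φ σ μ β) := by
    refine Integrable.mono' ((integrable_norm_totalScore hμ hφ β).const_mul R)
      (Measurable.aestronglyMeasurable (by fun_prop)) (ae_of_all _ fun Z => ?_)
    refine (norm_inner_le_norm _ _).trans ?_
    gcongr
    exact norm_meanOutput_le hTR Z
  simp only [correlation, h1]
  rw [integral_sub hi ((memLp_inner_totalScore hμ hφ β β).integrable one_le_two),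
    integral_inner_totalScore hμ hφ, sub_zero, ← (measurePreserving_linData hφ β).map_eq,
    integral_map (measurePreserving_linData (μ := μ) hφ β).aemeasurable
      (Measurable.aestronglyMeasurable (by fun_prop))]
  simp only [totalScore_linData]

theorem integrable_prior_sqErr (hφ : Measurable φ) (hT : Measurable T)
    (hTR : ∀ θ, ‖T θ‖ ≤ R) (a : ℝ) :
    Integrable (fun w => ∫ θ, ‖T θ - scaled a w.1‖ ^ 2 ∂(A (linData φ σ (scaled a w.1) w.2)))
      ((stdPrior ι).prod
        ((Measure.pi μ).prod (Measure.pi fun _ : Fin n => gaussianReal 0 1))) := by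
  have hβ := measurable_scaled (ι := ι) a
  let A₁ : Kernel ((ι → ℝ) × ((Fin n → 𝒳) × (Fin n → ℝ))) Θ :=
    A.comap _ (measurable_linData_scaled hφ σ a)
  have hb : Integrable (fun w : (ι → ℝ) × ((Fin n → 𝒳) × (Fin n → ℝ)) =>
      2 * R ^ 2 + 2 * ‖scaled a w.1‖ ^ 2) ((stdPrior ι).prod
        ((Measure.pi μ).prod (Measure.pi fun _ : Fin n => gaussianReal 0 1))) :=
    (integrable_const _).add (((integrable_norm_sq_scaled a).comp_fst _).const_mul 2)
  refine integrable_integral_kernel (κ := A₁)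
    (G := fun q => ‖T q.2 - scaled a q.1.1‖ ^ 2) (by fun_prop) hb fun w θ => ?_
  rw [abs_of_nonneg (by positivity)]
  nlinarith [norm_sub_sq_le hTR θ (scaled a w.1), sq_nonneg (R - ‖scaled a w.1‖)]

theorem integrable_prior_correlation (hμ : ∀ i, IsBoundedDesign φ C (μ i)) (hφ : Measurable φ)
    (hT : Measurable T) (hTR : ∀ θ, ‖T θ‖ ≤ R) (a : ℝ) :
    Integrable (fun w => inner ℝ (meanOutput A T (linData φ σ (scaled a w.1) w.2))
        (∑ i, (σ * w.2.2 i) • φ (w.2.1 i)))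
      ((stdPrior ι).prod
        ((Measure.pi μ).prod (Measure.pi fun _ : Fin n => gaussianReal 0 1))) := by
  have hm := measurable_meanOutput (A := A) hT
  have hD := measurable_linData_scaled (n := n) hφ σ a
  have hb := ((measurePreserving_linData (σ := σ) (μ := μ) hφ 0).integrable_comp_of_integrable
    (integrable_norm_totalScore hμ hφ 0)).comp_snd (stdPrior ι)
  simp only [Function.comp_apply, totalScore_linData] at hb
  refine Integrable.mono' (hb.const_mul R)
    (Measurable.aestronglyMeasurable (by fun_prop)) (ae_of_all _ fun w => ?_)
  refine (norm_inner_le_norm _ _).trans ?_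
  gcongr
  exact norm_meanOutput_le hTR _

theorem integrable_meanSqErr (hφ : Measurable φ) (hT : Measurable T)
    (hTR : ∀ θ, ‖T θ‖ ≤ R) (a : ℝ) :
    Integrable (fun g => meanSqErr φ σ μ A T (scaled a g)) (stdPrior ι) := by
  simp only [meanSqErr_eq hφ hT]
  exact (integrable_prior_sqErr hφ hT hTR a).integral_prod_left

theorem integrable_correlation (hμ : ∀ i, IsBoundedDesign φ C (μ i)) (hφ : Measurable φ)
    (hT : Measurable T) (hTR : ∀ θ, ‖T θ‖ ≤ R) (a : ℝ) :
    Integrable (fun g => correlation φ σ μ A T (scaled a g)) (stdPrior ι) := by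
  simp only [correlation_eq hμ hφ hT hTR]
  exact (integrable_prior_correlation hμ hφ hT hTR a).integral_prod_left

/-- On average over the prior `N(0, a² I)`, an accurate estimator is strongly correlated with the
score: the correlation equals `σ² / a²` times the mean of `⟨T θ, β⟩`. -/
theorem le_integral_correlation (hμ : ∀ i, IsBoundedDesign φ C (μ i)) (hφ : Measurable φ)
    (hT : Measurable T) (hTR : ∀ θ, ‖T θ‖ ≤ R) {a : ℝ} (ha : a ≠ 0) :
    σ ^ 2 / a ^ 2 * (3 / 4 * (a ^ 2 * Fintype.card ι)
      - ∫ g, meanSqErr φ σ μ A T (scaled a g) ∂(stdPrior ι)) ≤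
      ∫ g, correlation φ σ μ A T (scaled a g) ∂(stdPrior ι) := by
  have hm := measurable_meanOutput (A := A) hT
  have hD := measurable_linData_scaled (n := n) hφ σ a
  have hβ := measurable_scaled (ι := ι) a
  set Q := (Measure.pi μ).prod (Measure.pi fun _ : Fin n => gaussianReal 0 1)
  let M : (ι → ℝ) × ((Fin n → 𝒳) × (Fin n → ℝ)) → EuclideanSpace ℝ ι := fun w =>
    meanOutput A T (linData φ σ (scaled a w.1) w.2)
  have hM : Measurable M := hm.comp hD
  have hMR : ∀ w, ‖M w‖ ≤ R := fun w => norm_meanOutput_le hTR _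
  have hf1 := integrable_prior_correlation (σ := σ) (A := A) hμ hφ hT hTR a
  have hf2 := integrable_prior_sqErr (σ := σ) (A := A) (μ := μ) hφ hT hTR a
  have hf3 : Integrable (fun w => inner ℝ (M w) (scaled a w.1)) ((stdPrior ι).prod Q) := by
    refine Integrable.mono' (((integrable_norm_scaled a).comp_fst Q).const_mul R)
      (Measurable.aestronglyMeasurable (by fun_prop)) (ae_of_all _ fun w => ?_)
    refine (norm_inner_le_norm _ _).trans ?_
    gcongr
    exact hMR w
  have hf4 : Integrable (fun w : (ι → ℝ) × ((Fin n → 𝒳) × (Fin n → ℝ)) => ‖scaled a w.1‖ ^ 2)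
      ((stdPrior ι).prod Q) := (integrable_norm_sq_scaled a).comp_fst Q
  have hstein : ∫ w, (inner ℝ (M w) (∑ i, (σ * w.2.2 i) • φ (w.2.1 i))
      - σ ^ 2 / a ^ 2 * inner ℝ (M w) (scaled a w.1)) ∂((stdPrior ι).prod Q) = 0 := by
    have hmp := measurePreserving_prior_design_noise (ι := ι) μ
    have hi := hmp.integrable_comp_of_integrable (hf1.sub (hf3.const_mul (σ ^ 2 / a ^ 2)))
    rw [← hmp.map_eq, integral_map hmp.aemeasurable
      (Measurable.aestronglyMeasurable (by fun_prop))]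
    refine (integral_prod _ hi).trans ?_
    have hz : ∀ x, ∫ u, ((fun w => inner ℝ (M w) (∑ i, (σ * w.2.2 i) • φ (w.2.1 i))
        - σ ^ 2 / a ^ 2 * inner ℝ (M w) (scaled a w.1)) ∘
          fun w : (Fin n → 𝒳) × (ι ⊕ Fin n → ℝ) =>
            ((fun k => w.2 (Sum.inl k)), (w.1, fun i => w.2 (Sum.inr i)))) (x, u)
          ∂(Measure.pi fun _ => gaussianReal 0 1) = 0 := fun x => by
      have h0 := integral_inner_posterior_score_eq_zero x σ ha hm (norm_meanOutput_le hTR) hφ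
      refine Eq.trans ?_ ((integral_const_mul σ _).trans ((congrArg (σ * ·) h0).trans (mul_zero σ)))
      refine integral_congr_ae (ae_of_all _ fun u => ?_)
      simp only [M, Function.comp_apply, inner_sub_right, inner_smul_right, mul_smul,
        ← Finset.smul_sum]
      ring
    exact integral_eq_zero_of_ae (ae_of_all _ hz)
  have hlow : ∫ w, (3 / 4 * ‖scaled a w.1‖ ^ 2
      - ∫ θ, ‖T θ - scaled a w.1‖ ^ 2 ∂(A (linData φ σ (scaled a w.1) w.2)))
        ∂((stdPrior ι).prod Q) ≤
      ∫ w, inner ℝ (M w) (scaled a w.1) ∂((stdPrior ι).prod Q) := by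
    refine integral_mono ((hf4.const_mul _).sub hf2) hf3 fun w => ?_
    set β := scaled a w.1
    set Z := linData φ σ β w.2
    have hi := integrable_norm_sub_sq hT hTR β (A Z)
    have hi' : Integrable (fun θ => inner ℝ (T θ) β) (A Z) := by
      simpa using integrable_inner_sub hT hTR 0 β (A Z)
    calc 3 / 4 * ‖β‖ ^ 2 - ∫ θ, ‖T θ - β‖ ^ 2 ∂(A Z)
        = ∫ θ, (3 / 4 * ‖β‖ ^ 2 - ‖T θ - β‖ ^ 2) ∂(A Z) := by
          rw [integral_sub (integrable_const _) hi]; simp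
      _ ≤ ∫ θ, inner ℝ (T θ) β ∂(A Z) := by
          refine integral_mono ((integrable_const _).sub hi) hi' fun θ => ?_
          have h1 : inner ℝ (T θ) β = ‖β‖ ^ 2 + inner ℝ (T θ - β) β := by
            rw [inner_sub_left, real_inner_self_eq_norm_sq]; ring
          have h2 := neg_le_of_abs_le (abs_real_inner_le_norm (T θ - β) β)
          show 3 / 4 * ‖β‖ ^ 2 - ‖T θ - β‖ ^ 2 ≤ inner ℝ (T θ) β
          rw [h1]
          nlinarith [sq_nonneg (‖T θ - β‖ - ‖β‖ / 2)]
      _ = inner ℝ (meanOutput A T Z) β := integral_inner_estimator hT hTR Z β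
  have e1 : ∫ g, correlation φ σ μ A T (scaled a g) ∂(stdPrior ι) =
      ∫ w, inner ℝ (M w) (∑ i, (σ * w.2.2 i) • φ (w.2.1 i)) ∂((stdPrior ι).prod Q) := by
    simp only [correlation_eq hμ hφ hT hTR]
    exact (integral_prod _ hf1).symm
  have e2 : ∫ g, meanSqErr φ σ μ A T (scaled a g) ∂(stdPrior ι) =
      ∫ w, ∫ θ, ‖T θ - scaled a w.1‖ ^ 2 ∂(A (linData φ σ (scaled a w.1) w.2))
        ∂((stdPrior ι).prod Q) := by
    simp only [meanSqErr_eq hφ hT]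
    exact (integral_prod _ hf2).symm
  have e3 : ∫ w : (ι → ℝ) × ((Fin n → 𝒳) × (Fin n → ℝ)), ‖scaled a w.1‖ ^ 2
      ∂((stdPrior ι).prod Q) = a ^ 2 * Fintype.card ι := by
    rw [integral_prod _ hf4, ← integral_norm_sq_scaled]
    simp
  rw [integral_sub hf1 (hf3.const_mul _), integral_const_mul, ← e1] at hstein
  rw [integral_sub (hf4.const_mul _) hf2, integral_const_mul, e3, ← e2] at hlow
  have hpos : 0 ≤ σ ^ 2 / a ^ 2 := by positivity
  nlinarith [mul_le_mul_of_nonneg_left hlow hpos]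

end Stein

/-! ### Clipping -/

section Clip

variable {V : Type*} [NormedAddCommGroup V]

/-- Replace vectors of norm larger than `R` by zero. Sending them to zero rather than to the sphere
is enough for `norm_clip_sub_sq_le`. -/
def clip (R : ℝ) (v : V) : V := (Metric.closedBall (0 : V) R).indicator id v

theorem measurable_clip [MeasurableSpace V] [OpensMeasurableSpace V] (R : ℝ) :
    Measurable (clip R : V → V) :=
  measurable_id.indicator Metric.isClosed_closedBall.measurableSet

theorem norm_clip_le {R : ℝ} (hR : 0 ≤ R) (v : V) : ‖clip R v‖ ≤ R := by
  by_cases h : v ∈ Metric.closedBall (0 : V) R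
  · simpa only [clip, Set.indicator_of_mem h, id_eq, mem_closedBall_zero_iff] using h
  · simpa [clip, h] using hR

/-- Clipping does not increase the error when `‖β‖ ≤ R / 2`, and costs at most `‖β‖²` otherwise. -/
theorem norm_clip_sub_sq_le {R : ℝ} (hR : 0 < R) (v β : V) :
    ‖clip R v - β‖ ^ 2 ≤ ‖v - β‖ ^ 2 + 4 * ‖β‖ ^ 4 / R ^ 2 := by
  have h0 : 0 ≤ 4 * ‖β‖ ^ 4 / R ^ 2 := by positivity
  by_cases h : v ∈ Metric.closedBall (0 : V) R
  · simpa [clip, h] using h0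
  · have hv : R < ‖v‖ := by simpa using h
    simp only [clip, Set.indicator_of_notMem h, zero_sub, norm_neg]
    by_cases hβ : ‖β‖ ≤ R / 2
    · have h1 : ‖β‖ ≤ ‖v - β‖ := by
        have := norm_sub_norm_le v β
        linarith
      nlinarith [norm_nonneg β]
    · have h1 : R ^ 2 ≤ 4 * ‖β‖ ^ 2 := by nlinarith [not_le.1 hβ]
      have h2 : ‖β‖ ^ 2 ≤ 4 * ‖β‖ ^ 4 / R ^ 2 := by
        rw [le_div_iff₀ (by positivity)]
        nlinarith [sq_nonneg ‖β‖]
      nlinarith [sq_nonneg ‖v - β‖]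

end Clip

/-! ### Lower bounds for linear regression -/

section LowerBounds

variable {ι 𝒳 Θ : Type*} [Fintype ι] [MeasurableSpace 𝒳] [MeasurableSpace Θ] {n : ℕ}
variable {φ : 𝒳 → EuclideanSpace ℝ ι} {σ C : ℝ} {μ : Fin n → Measure 𝒳}
  {A : Kernel (Fin n → 𝒳 × ℝ) Θ} {S : Θ → EuclideanSpace ℝ ι} {s : ℝ}

/-- The risk of the estimator `S θ`, possibly infinite. -/
def linRisk (φ : 𝒳 → EuclideanSpace ℝ ι) (σ : ℝ) (μ : Fin n → Measure 𝒳)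
    (A : Kernel (Fin n → 𝒳 × ℝ) Θ) (S : Θ → EuclideanSpace ℝ ι) (β : EuclideanSpace ℝ ι) :
    ENNReal :=
  ∫⁻ Z, ∫⁻ θ, ENNReal.ofReal (‖S θ - β‖ ^ 2) ∂(A Z) ∂(linSampleLaw φ σ μ β)

variable [∀ i, IsProbabilityMeasure (μ i)] [IsMarkovKernel A]

theorem meanSqErr_clip_le (hφ : Measurable φ) (hS : Measurable S) {R : ℝ} (hR : 0 < R)
    (hs : 0 ≤ s) {β : EuclideanSpace ℝ ι} (h : linRisk φ σ μ A S β ≤ ENNReal.ofReal s) :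
    meanSqErr φ σ μ A (fun θ => clip R (S θ)) β ≤ s + 4 * ‖β‖ ^ 4 / R ^ 2 := by
  have hpr := isProbabilityMeasure_linSampleLaw (σ := σ) (μ := μ) hφ β
  have hT : Measurable fun θ => clip R (S θ) := (measurable_clip R).comp hS
  have hTR : ∀ θ, ‖clip R (S θ)‖ ≤ R := fun θ => norm_clip_le hR.le _
  have hc : 0 ≤ 4 * ‖β‖ ^ 4 / R ^ 2 := by positivity
  rw [← ENNReal.ofReal_le_ofReal_iff (by positivity), meanSqErr,
    ofReal_integral_eq_lintegral_ofReal (integrable_integral_norm_sub_sq hφ hT hTR β)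
      (ae_of_all _ fun Z => integral_nonneg fun θ => by positivity), ENNReal.ofReal_add hs hc]
  calc ∫⁻ Z, ENNReal.ofReal (∫ θ, ‖clip R (S θ) - β‖ ^ 2 ∂(A Z)) ∂(linSampleLaw φ σ μ β)
      ≤ ∫⁻ Z, (∫⁻ θ, ENNReal.ofReal (‖S θ - β‖ ^ 2) ∂(A Z)
          + ENNReal.ofReal (4 * ‖β‖ ^ 4 / R ^ 2)) ∂(linSampleLaw φ σ μ β) := by
        refine lintegral_mono fun Z => ?_
        rw [ofReal_integral_eq_lintegral_ofReal (integrable_norm_sub_sq hT hTR β _)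
          (ae_of_all _ fun θ => by positivity)]
        calc ∫⁻ θ, ENNReal.ofReal (‖clip R (S θ) - β‖ ^ 2) ∂(A Z)
            ≤ ∫⁻ θ, (ENNReal.ofReal (‖S θ - β‖ ^ 2)
                + ENNReal.ofReal (4 * ‖β‖ ^ 4 / R ^ 2)) ∂(A Z) := by
              refine lintegral_mono fun θ => ?_
              rw [← ENNReal.ofReal_add (by positivity) hc]
              exact ENNReal.ofReal_le_ofReal (norm_clip_sub_sq_le hR _ _)
          _ = _ := by rw [lintegral_add_right _ measurable_const]; simp
    _ = linRisk φ σ μ A S β + ENNReal.ofReal (4 * ‖β‖ ^ 4 / R ^ 2) := by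
        rw [lintegral_add_right _ measurable_const, linRisk]; simp
    _ ≤ _ := by gcongr

theorem gaussianFourthMoment_nonneg : 0 ≤ gaussianFourthMoment :=
  integral_nonneg fun x => by positivity

/-- Average error of the clipped estimator. The radius `R` is chosen so that clipping costs at most
one eighth of the prior variance `a² p`, by the fourth moment of the prior. -/
theorem integral_meanSqErr_clip_le [Nonempty ι] (hφ : Measurable φ) (hS : Measurable S) {R a : ℝ}
    (hR : 0 < R) (ha : a ≠ 0) (hs : 0 ≤ s)
    (h : ∀ β ≠ 0, linRisk φ σ μ A S β ≤ ENNReal.ofReal s)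
    (hRa : 32 * gaussianFourthMoment * (a ^ 2 * Fintype.card ι) ≤ R ^ 2) :
    ∫ g, meanSqErr φ σ μ A (fun θ => clip R (S θ)) (scaled a g) ∂(stdPrior ι) ≤
      s + a ^ 2 * Fintype.card ι / 8 := by
  have hT : Measurable fun θ => clip R (S θ) := (measurable_clip R).comp hS
  have hTR : ∀ θ, ‖clip R (S θ)‖ ≤ R := fun θ => norm_clip_le hR.le _
  have h4 := integrable_norm_pow_four_scaled (ι := ι) a
  set m := gaussianFourthMoment with hm
  set p : ℝ := (Fintype.card ι : ℝ)
  calc ∫ g, meanSqErr φ σ μ A (fun θ => clip R (S θ)) (scaled a g) ∂(stdPrior ι)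
      ≤ ∫ g, (s + 4 / R ^ 2 * ‖scaled a g‖ ^ 4) ∂(stdPrior ι) := by
        refine integral_mono_ae (integrable_meanSqErr hφ hT hTR a)
          ((integrable_const s).add (h4.const_mul _)) ?_
        filter_upwards [ae_scaled_ne_zero (ι := ι) ha] with g hg
        exact (meanSqErr_clip_le hφ hS hR hs (h _ hg)).trans (le_of_eq (by ring))
    _ = s + 4 / R ^ 2 * ∫ g, ‖scaled a g‖ ^ 4 ∂(stdPrior ι) := by
        rw [integral_add (integrable_const s) (h4.const_mul _), integral_const_mul]
        simp
    _ ≤ s + 4 / R ^ 2 * (m * (a ^ 2 * p) ^ 2) := by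
        have := integral_norm_pow_four_scaled_le (ι := ι) a
        gcongr
    _ ≤ s + a ^ 2 * p / 8 := by
        have hp : 0 ≤ a ^ 2 * p := by positivity
        have : 4 / R ^ 2 * (m * (a ^ 2 * p) ^ 2) ≤ a ^ 2 * p / 8 := by
          rw [div_mul_eq_mul_div, div_le_iff₀ (by positivity)]
          nlinarith [mul_le_mul_of_nonneg_right hRa hp]
        linarith

/-- If the average error is at most a quarter of the prior variance, the average correlation is at
least half of `σ² p`. -/
theorem half_le_integral_correlation [Nonempty ι] (hμ : ∀ i, IsBoundedDesign φ C (μ i))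
    (hφ : Measurable φ) (hS : Measurable S) {R a : ℝ} (hR : 0 < R) (ha : a ≠ 0)
    (hρ : ∫ g, meanSqErr φ σ μ A (fun θ => clip R (S θ)) (scaled a g) ∂(stdPrior ι) ≤
      a ^ 2 * Fintype.card ι / 4) :
    σ ^ 2 * Fintype.card ι / 2 ≤
      ∫ g, correlation φ σ μ A (fun θ => clip R (S θ)) (scaled a g) ∂(stdPrior ι) := by
  refine le_trans ?_ (le_integral_correlation (T := fun θ => clip R (S θ)) hμ hφ
    ((measurable_clip R).comp hS) (fun θ => norm_clip_le hR.le _) ha)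
  have h2 : 0 < a ^ 2 := by positivity
  have h1 : σ ^ 2 / a ^ 2 * (a ^ 2 * Fintype.card ι / 2) = σ ^ 2 * Fintype.card ι / 2 := by
    field_simp
  rw [← h1]
  gcongr
  linarith

/-- The lower bound of order `σ² p / n`, which holds for all algorithms. -/
theorem le_of_linRisk_le [Nonempty ι] (hμ : ∀ i, IsBoundedDesign φ C (μ i))
    (hφ : Measurable φ) (hS : Measurable S) (hσ : 0 < σ) (hC : 0 < C) (hn : 1 ≤ n) (hs : 0 ≤ s)
    (h : ∀ β ≠ 0, linRisk φ σ μ A S β ≤ ENNReal.ofReal s) :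
    1 / (8 * C) * (σ ^ 2 * Fintype.card ι / n) ≤ s := by
  by_contra! hlt
  have hn0 : (0 : ℝ) < n := by exact_mod_cast hn
  set p : ℝ := (Fintype.card ι : ℝ) with hp
  -- At this prior scale `a² p / 8` is the claimed bound.
  set a := σ / √(n * C) with ha
  have ha0 : 0 < a := by positivity
  have ha2 : a ^ 2 = σ ^ 2 / (n * C) := by
    rw [ha, div_pow, Real.sq_sqrt (by positivity)]
  set R := √(32 * gaussianFourthMoment * (a ^ 2 * p) + 1)
  have hm := gaussianFourthMoment_nonneg
  have hR0 : 0 < R := by positivity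
  have hR2 : 32 * gaussianFourthMoment * (a ^ 2 * p) ≤ R ^ 2 := by
    rw [Real.sq_sqrt (by positivity)]; linarith
  have hρ := integral_meanSqErr_clip_le hφ hS hR0 ha0.ne' hs h hR2
  have e : 1 / (8 * C) * (σ ^ 2 * p / n) = a ^ 2 * p / 8 := by rw [ha2]; field_simp
  rw [e] at hlt
  have hlow := half_le_integral_correlation (σ := σ) (A := A) hμ hφ hS hR0 ha0.ne' (by linarith)
  have hT : Measurable fun θ => clip R (S θ) := (measurable_clip R).comp hS
  have hTR : ∀ θ, ‖clip R (S θ)‖ ≤ R := fun θ => norm_clip_le hR0.le _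
  have hq := integrable_meanSqErr (σ := σ) (A := A) (μ := μ) hφ hT hTR a
  have ht : 0 < 2 * n * C := by positivity
  have hup := integral_mono (integrable_correlation (σ := σ) (A := A) hμ hφ hT hTR a)
    ((hq.const_mul (2 * n * C / 2)).add
      (integrable_const (n * (σ ^ 2 * C * p) / (2 * (2 * n * C)))))
    fun g => correlation_le (A := A) hμ hφ hT hTR (scaled a g) ht
  simp only [Pi.add_apply] at hup
  rw [integral_add (hq.const_mul _) (integrable_const _), integral_const_mul] at hup
  simp only [integral_const, probReal_univ, one_smul] at hup
  have e1 : n * (σ ^ 2 * C * p) / (2 * (2 * n * C)) = σ ^ 2 * p / 4 := by field_simp; norm_num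
  have e2 : 2 * n * C / 2 * (a ^ 2 * p / 4) = σ ^ 2 * p / 4 := by rw [ha2]; field_simp
  have h3 := mul_lt_mul_of_pos_left (hρ.trans_lt (b := s + a ^ 2 * p / 8)
    (c := a ^ 2 * p / 4) (by linarith)) (half_pos ht)
  linarith

/-- The effect of `δ` on the lower bound is negligible once `n δ` times this constant is at most
`1 / 4`; the square root is the clipping radius in units of the noise level. -/
def privacyConst (C C₁ : ℝ) : ℝ :=
  (C + 1) * (√(32 * gaussianFourthMoment * (C₁ ^ 2 / (16 * C)) + 1)
    + (C₁ ^ 2 / (16 * C) + 1) / 2)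

theorem privacyConst_nonneg {C : ℝ} (hC : 0 < C) (C₁ : ℝ) : 0 ≤ privacyConst C C₁ := by
  unfold privacyConst; positivity

/-- The lower bound of order `σ² p² / (n² ε²)` for private algorithms. -/
theorem le_of_linRisk_le_of_private [Nonempty ι] (hμ : ∀ i, IsBoundedDesign φ C (μ i))
    (hφ : Measurable φ) (hS : Measurable S) (hσ : 0 < σ) (hC : 0 < C) (hn : 1 ≤ n) (hs : 0 ≤ s)
    (h : ∀ β ≠ 0, linRisk φ σ μ A S β ≤ ENNReal.ofReal s) {ε δ C₁ : ℝ}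
    (hε : 0 < ε) (hε1 : ε < 1) (hδ : 0 ≤ δ)
    (hA : ∀ i, ∀ Z Z' : Fin n → 𝒳 × ℝ, (∀ j, j ≠ i → Z j = Z' j) → ∀ Q, MeasurableSet Q →
      A Z Q ≤ ENNReal.ofReal (Real.exp ε) * A Z' Q + ENNReal.ofReal δ)
    (hC₁ : Fintype.card ι ≤ C₁ * (n * ε)) (hδn : n * δ * privacyConst C C₁ ≤ 1 / 4) :
    1 / (128 * C) * (σ ^ 2 * Fintype.card ι ^ 2 / (n ^ 2 * ε ^ 2)) ≤ s := by
  by_contra! hlt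
  have hn0 : (0 : ℝ) < n := by exact_mod_cast hn
  have hp0 : (0 : ℝ) < Fintype.card ι := by exact_mod_cast Fintype.card_pos
  set p : ℝ := (Fintype.card ι : ℝ) with hp
  -- At this prior scale `a² p / 8` is the claimed bound.
  set a := √(σ ^ 2 * p / (16 * C * n ^ 2 * ε ^ 2)) with ha
  have ha0 : 0 < a := by positivity
  have ha2 : a ^ 2 = σ ^ 2 * p / (16 * C * n ^ 2 * ε ^ 2) := by
    rw [ha, Real.sq_sqrt (by positivity)]
  set b := C₁ ^ 2 / (16 * C) with hb
  have hb0 : 0 ≤ b := by positivity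
  -- As `p ≤ C₁ n ε`, the prior signal is at most of the order of the noise, so that the clipping
  -- radius `σ L` and hence the cost of `δ` do not depend on the dimensions.
  have hap : a ^ 2 * p ≤ σ ^ 2 * b := by
    rw [ha2, hb, div_mul_eq_mul_div, mul_div_assoc',
      div_le_div_iff₀ (by positivity) (by positivity)]
    have : p ^ 2 ≤ (C₁ * (n * ε)) ^ 2 := by gcongr
    nlinarith [mul_le_mul_of_nonneg_left this (show 0 ≤ σ ^ 2 * (16 * C) by positivity)]
  have hm := gaussianFourthMoment_nonneg
  set L := √(32 * gaussianFourthMoment * b + 1) with hL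
  have hL0 : 0 < L := by positivity
  have hR0 : 0 < σ * L := by positivity
  have hR2 : 32 * gaussianFourthMoment * (a ^ 2 * p) ≤ (σ * L) ^ 2 := by
    have hL2 : L ^ 2 = 32 * gaussianFourthMoment * b + 1 := Real.sq_sqrt (by positivity)
    rw [mul_pow, hL2]
    linarith [mul_le_mul_of_nonneg_left hap hm, sq_nonneg σ]
  have hρ := integral_meanSqErr_clip_le hφ hS hR0 ha0.ne' hs h hR2
  have e : 1 / (128 * C) * (σ ^ 2 * p ^ 2 / (n ^ 2 * ε ^ 2)) = a ^ 2 * p / 8 := by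
    rw [ha2]; field_simp; norm_num
  rw [e] at hlt
  have hρ' := hρ.trans_lt (b := s + a ^ 2 * p / 8) (c := a ^ 2 * p / 4) (by linarith)
  have hlow := half_le_integral_correlation (σ := σ) (A := A) hμ hφ hS hR0 ha0.ne' hρ'.le
  have hT : Measurable fun θ => clip (σ * L) (S θ) := (measurable_clip _).comp hS
  have hTR : ∀ θ, ‖clip (σ * L) (S θ)‖ ≤ σ * L := fun θ => norm_clip_le hR0.le _
  have hq := integrable_meanSqErr (σ := σ) (A := A) (μ := μ) hφ hT hTR a
  have hnorm := integrable_norm_sq_scaled (ι := ι) a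
  -- This `t` balances the two terms that `ε` contributes at `σ² p / 8` each.
  set t := 8 * n * ε / p with ht
  have ht0 : 0 < t := by positivity
  set ρ := ∫ g, meanSqErr φ σ μ A (fun θ => clip (σ * L) (S θ)) (scaled a g) ∂(stdPrior ι)
  have he : Real.exp ε - 1 ≤ 2 * ε := by
    have := Real.abs_exp_sub_one_le (x := ε) (by rw [abs_of_pos hε]; exact hε1.le)
    rw [abs_of_pos hε] at this
    exact (le_abs_self _).trans this
  have he0 : 0 ≤ Real.exp ε - 1 := sub_nonneg.2 (Real.one_le_exp hε.le)
  -- `‖β‖ ≤ (‖β‖² / σ + σ) / 2` turns the bound into one that is affine in the square norm.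
  have hpt : ∀ g, correlation φ σ μ A (fun θ => clip (σ * L) (S θ)) (scaled a g) ≤
      n * (Real.exp ε - 1) * (t * C / 2) *
          meanSqErr φ σ μ A (fun θ => clip (σ * L) (S θ)) (scaled a g)
        + n * δ * (C + 1) * p / 2 * ‖scaled a g‖ ^ 2
        + (n * (Real.exp ε - 1) * (σ ^ 2 / (2 * t))
          + n * δ * (C + 1) * p * σ ^ 2 * (L + 1 / 2)) := by
    intro g
    refine (correlation_le_of_private hμ hφ hT hTR (scaled a g) hσ hC.le hR0.le hε.le hδ ht0
      hA).trans ?_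
    have h1 : 2 * (σ * ‖scaled a g‖) ≤ ‖scaled a g‖ ^ 2 + σ ^ 2 := by
      nlinarith [sq_nonneg (‖scaled a g‖ - σ)]
    have h2 : 0 ≤ n * δ * (C + 1) * p := by positivity
    have h3 := mul_le_mul_of_nonneg_left h1 h2
    rw [← hp]
    linarith
  have hup := integral_mono (integrable_correlation (σ := σ) (A := A) hμ hφ hT hTR a)
    (((hq.const_mul _).add (hnorm.const_mul _)).add (integrable_const _)) hpt
  simp only [Pi.add_apply] at hup
  have hq2 : Integrable (fun g => n * (Real.exp ε - 1) * (t * C / 2) *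
          meanSqErr φ σ μ A (fun θ => clip (σ * L) (S θ)) (scaled a g)
        + n * δ * (C + 1) * p / 2 * ‖scaled a g‖ ^ 2) (stdPrior ι) :=
    (hq.const_mul _).add (hnorm.const_mul _)
  rw [integral_add hq2 (integrable_const _), integral_add (hq.const_mul _) (hnorm.const_mul _),
    integral_const_mul, integral_const_mul, integral_norm_sq_scaled] at hup
  simp only [integral_const, probReal_univ, one_smul] at hup
  have k1 : n * (Real.exp ε - 1) * (t * C / 2) * ρ < σ ^ 2 * p / 8 := by
    have e1 : n * (2 * ε) * (t * C / 2) * (a ^ 2 * p / 4) = σ ^ 2 * p / 8 := by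
      rw [ha2, ht]; field_simp; norm_num
    rw [← e1]
    have hρ0 : 0 ≤ ρ := integral_nonneg fun g =>
      integral_nonneg fun Z => integral_nonneg fun θ => by positivity
    calc n * (Real.exp ε - 1) * (t * C / 2) * ρ ≤ n * (2 * ε) * (t * C / 2) * ρ := by gcongr
      _ < _ := by gcongr
  have k2 : n * (Real.exp ε - 1) * (σ ^ 2 / (2 * t)) ≤ σ ^ 2 * p / 8 := by
    have e1 : n * (2 * ε) * (σ ^ 2 / (2 * t)) = σ ^ 2 * p / 8 := by
      rw [ht]; field_simp
    rw [← e1]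
    gcongr
  have k3 : n * δ * (C + 1) * p / 2 * (a ^ 2 * p) + n * δ * (C + 1) * p * σ ^ 2 * (L + 1 / 2) ≤
      σ ^ 2 * p / 4 := by
    have h2 : 0 ≤ n * δ * (C + 1) * p / 2 := by positivity
    have h3 := mul_le_mul_of_nonneg_left hap h2
    have h4 := mul_le_mul_of_nonneg_right hδn (show 0 ≤ σ ^ 2 * p by positivity)
    simp only [privacyConst, ← hb, ← hL] at h4
    linarith
  linarith

end LowerBounds

/-! ### Low rank matrices with free coordinates -/

theorem dotProduct_mulVec_le_of_eigenvalues_le {κ : Type*} [Fintype κ] [DecidableEq κ]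
    {Λ : Matrix κ κ ℝ} (h : Λ.IsHermitian) {C : ℝ} (hC : ∀ k, h.eigenvalues k ≤ C)
    (v : EuclideanSpace ℝ κ) : v.ofLp ⬝ᵥ Λ.mulVec v.ofLp ≤ C * ‖v‖ ^ 2 := by
  set b := h.eigenvectorBasis
  have hinner : ∀ x y : EuclideanSpace ℝ κ, inner ℝ x y = x.ofLp ⬝ᵥ y.ofLp := fun x y => by
    rw [EuclideanSpace.inner_eq_star_dotProduct, dotProduct_comm]; rfl
  have hsymm : Λ.transpose = Λ := by simpa [Matrix.IsHermitian] using h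
  have hb : ∀ k, inner ℝ (b k) (WithLp.toLp 2 (Λ.mulVec v.ofLp)) =
      h.eigenvalues k * inner ℝ (b k) v := fun k => by
    rw [hinner, hinner, Matrix.dotProduct_mulVec, ← Matrix.mulVec_transpose, hsymm,
      h.mulVec_eigenvectorBasis, smul_dotProduct, smul_eq_mul]
  have h1 : v.ofLp ⬝ᵥ Λ.mulVec v.ofLp = inner ℝ v (WithLp.toLp 2 (Λ.mulVec v.ofLp)) := by
    rw [hinner]
  rw [h1, ← b.sum_inner_mul_inner, ← b.sum_sq_inner_right, Finset.mul_sum]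
  refine Finset.sum_le_sum fun k _ => ?_
  rw [hb, real_inner_comm]
  nlinarith [mul_le_mul_of_nonneg_right (hC k) (sq_nonneg (inner ℝ (b k) v))]

section Embedding

variable {ι : Type*} {d₁ d₂ : ℕ} (e : ι → Fin d₁ × Fin d₂)

/-- The entries of `X` at the positions `e k`. -/
def entries (X : Matrix (Fin d₁) (Fin d₂) ℝ) : EuclideanSpace ℝ ι :=
  WithLp.toLp 2 fun k => X (e k).1 (e k).2

theorem measurable_entries : Measurable (entries e) := by
  refine (WithLp.measurable_toLp 2 _).comp (measurable_pi_iff.2 fun k => ?_)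
  exact (measurable_pi_apply (e k).2).comp (measurable_pi_apply (e k).1)

variable [Fintype ι]

/-- The matrix with entries `β k` at the positions `e k` and zeros elsewhere, for injective `e`. -/
def embed (β : EuclideanSpace ℝ ι) : Matrix (Fin d₁) (Fin d₂) ℝ :=
  Matrix.of fun i j => ∑ k, if e k = (i, j) then β k else 0

theorem traceInner_embed (X : Matrix (Fin d₁) (Fin d₂) ℝ) (β : EuclideanSpace ℝ ι) :
    traceInner X (embed e β) = inner ℝ (entries e X) β := by
  simp only [traceInner, Matrix.trace, Matrix.diag, Matrix.mul_apply, Matrix.transpose_apply,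
    embed, Matrix.of_apply, entries, PiLp.inner_apply, RCLike.inner_apply, conj_trivial,
    Finset.mul_sum]
  rw [Finset.sum_comm, ← Fintype.sum_prod_type', Finset.sum_comm]
  refine Finset.sum_congr rfl fun k _ => ?_
  rw [Finset.sum_eq_single (e k)]
  · simp [mul_comm]
  · intro q _ hq
    rw [if_neg fun h => hq (by rw [h]), mul_zero]
  · simp

variable {e}

theorem entries_embed (he : Function.Injective e) (β : EuclideanSpace ℝ ι) :
    entries e (embed e β) = β := by
  classical
  ext k
  simp [entries, embed, he.eq_iff]

section

open scoped Matrix.Norms.Frobenius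

/-- Estimating the matrix by `B` is at least as hard as estimating its free entries. -/
theorem norm_entries_sub_sq_le (he : Function.Injective e) (B : Matrix (Fin d₁) (Fin d₂) ℝ)
    (β : EuclideanSpace ℝ ι) : ‖entries e B - β‖ ^ 2 ≤ ‖B - embed e β‖ ^ 2 := by
  have h1 : entries e B - β = entries e (B - embed e β) := by
    conv_lhs => rw [← entries_embed he β]
    rfl
  have h2 : ∀ D : Matrix (Fin d₁) (Fin d₂) ℝ, ‖D‖ ^ 2 = ∑ q : Fin d₁ × Fin d₂, D q.1 q.2 ^ 2 :=
    fun D => by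
      rw [Matrix.frobenius_norm_def, ← Real.sqrt_eq_rpow, Real.sq_sqrt (by positivity),
        Fintype.sum_prod_type]
      simp
  rw [h1, h2, EuclideanSpace.real_norm_sq_eq]
  set D := B - embed e β
  calc ∑ k, entries e D k ^ 2 = ∑ q ∈ Finset.univ.map ⟨e, he⟩, D q.1 q.2 ^ 2 := by
        rw [Finset.sum_map]; rfl
    _ ≤ _ := Finset.sum_le_univ_sum_of_nonneg fun q => sq_nonneg _

end

theorem obsLaw_embed (σ : ℝ) (Λ : Matrix (Fin d₂ × Fin d₁) (Fin d₂ × Fin d₁) ℝ)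
    (β : EuclideanSpace ℝ ι) :
    obsLaw σ Λ (embed e β) = linObsLaw (entries e) σ (designLaw Λ) β := by
  simp only [obsLaw, linObsLaw, traceInner_embed]

theorem linRisk_entries_le (he : Function.Injective e) {n : ℕ} (σ : ℝ)
    (Λ : Fin n → Matrix (Fin d₂ × Fin d₁) (Fin d₂ × Fin d₁) ℝ)
    (A : Kernel (Dataset n d₁ d₂) (Matrix (Fin d₁) (Fin d₂) ℝ)) (β : EuclideanSpace ℝ ι) :
    linRisk (entries e) σ (fun i => designLaw (Λ i)) A (entries e) β ≤ risk σ Λ A (embed e β) := by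
  simp only [linRisk, linSampleLaw, ← obsLaw_embed]
  exact lintegral_mono fun Z => lintegral_mono fun B =>
    ENNReal.ofReal_le_ofReal (norm_entries_sub_sq_le he B β)

theorem isBoundedDesign_designLaw (he : Function.Injective e) {Cu : ℝ}
    {Λ : Matrix (Fin d₂ × Fin d₁) (Fin d₂ × Fin d₁) ℝ} (h : Λ.PosDef)
    (hΛ : ∀ k, h.isHermitian.eigenvalues k ≤ Cu) :
    IsBoundedDesign (entries e) Cu (designLaw Λ) := by
  have hvec : ∀ v : EuclideanSpace ℝ ι, ∃ w : EuclideanSpace ℝ (Fin d₂ × Fin d₁),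
      ‖w‖ = ‖v‖ ∧ ∀ x, inner ℝ (entries e (mat x)) v = inner ℝ w x := by
    intro v
    let w : EuclideanSpace ℝ (Fin d₂ × Fin d₁) := WithLp.toLp 2 fun q => embed e v q.2 q.1
    have hw : ∀ x, inner ℝ (entries e (mat x)) v = inner ℝ w x := fun x => by
      rw [← traceInner_embed]
      simp only [traceInner, Matrix.trace, Matrix.diag, Matrix.mul_apply, Matrix.transpose_apply,
        mat, Matrix.of_apply, PiLp.inner_apply, RCLike.inner_apply, conj_trivial,
        Fintype.sum_prod_type, w]
    refine ⟨w, ?_, hw⟩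
    have h1 := hw w
    have h2 : mat w = embed e v := rfl
    rw [h2, entries_embed he, real_inner_self_eq_norm_sq, real_inner_self_eq_norm_sq] at h1
    exact ((sq_eq_sq₀ (norm_nonneg _) (norm_nonneg _)).1 h1).symm
  have hm : MemLp id 2 (multivariateGaussian (0 : EuclideanSpace ℝ (Fin d₂ × Fin d₁)) Λ) :=
    IsGaussian.memLp_two_id
  have hL : ∀ w : EuclideanSpace ℝ (Fin d₂ × Fin d₁),
      MemLp (fun x => inner ℝ w x) 2 (multivariateGaussian 0 Λ) := fun w =>
    hm.const_inner w
  have hmeas : ∀ v : EuclideanSpace ℝ ι, Measurable fun X => inner ℝ (entries e X) v :=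
    fun v => (measurable_entries e).inner measurable_const
  refine ⟨measurable_entries e, fun v => ?_, fun v => ?_⟩
  · obtain ⟨w, -, hw⟩ := hvec v
    rw [designLaw, memLp_map_measure_iff (hmeas v).aestronglyMeasurable measurable_mat.aemeasurable]
    exact (hL w).ae_eq (ae_of_all _ fun x => (hw x).symm)
  · obtain ⟨w, hwv, hw⟩ := hvec v
    rw [designLaw, integral_map measurable_mat.aemeasurable
      ((hmeas v).pow_const 2).aestronglyMeasurable]
    simp only [hw]
    have h0 : ∫ x, inner ℝ w x ∂(multivariateGaussian 0 Λ) = 0 := by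
      have := integral_inner (𝕜 := ℝ) (hm.integrable one_le_two) w
      simpa using this
    have h1 := covarianceBilin_multivariateGaussian (μ := 0) h.posSemidef w w
    rw [covarianceBilin_self hm, variance_of_integral_eq_zero
      (hL w).aestronglyMeasurable.aemeasurable h0] at h1
    rw [h1, ← hwv]
    exact dotProduct_mulVec_le_of_eigenvalues_le h.isHermitian hΛ w

theorem embed_ne_zero (he : Function.Injective e) {β : EuclideanSpace ℝ ι} (hβ : β ≠ 0) :
    embed e β ≠ 0 := fun h => hβ (by
  rw [← entries_embed he β, h]; rfl)

end Embedding

theorem one_le_rank_of_ne_zero {d₁ d₂ : ℕ} {M : Matrix (Fin d₁) (Fin d₂) ℝ} (h : M ≠ 0) :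
    1 ≤ M.rank := by
  rw [Nat.one_le_iff_ne_zero]
  intro h0
  refine h ?_
  have h1 : M.mulVecLin = 0 := LinearMap.range_eq_bot.1 (Submodule.finrank_eq_zero.1 h0)
  ext i j
  have := congrFun (LinearMap.congr_fun h1 (Pi.single j 1)) i
  simpa using this

/-- There are `r max(d₁, d₂)` positions such that all matrices supported on them have rank at most
`r`: the first `r` rows or the first `r` columns, whichever contain more entries. -/
theorem exists_low_rank_coordinates {d₁ d₂ r : ℕ} (hr : 1 ≤ r) (hrd : r ≤ min d₁ d₂) :
    ∃ (ι : Type) (_ : Fintype ι) (_ : Nonempty ι) (e : ι → Fin d₁ × Fin d₂),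
      Function.Injective e ∧ Fintype.card ι = r * max d₁ d₂ ∧
        ∀ β : EuclideanSpace ℝ ι, (embed e β).rank ≤ r := by
  have hr1 : r ≤ d₁ := hrd.trans (min_le_left _ _)
  have hr2 : r ≤ d₂ := hrd.trans (min_le_right _ _)
  have : NeZero r := ⟨by omega⟩
  have : NeZero d₁ := ⟨by omega⟩
  have : NeZero d₂ := ⟨by omega⟩
  rcases le_total d₁ d₂ with h | h
  · refine ⟨Fin r × Fin d₂, inferInstance, inferInstance,
      fun k => (Fin.castLE hr1 k.1, k.2), ?_, by simp [h], fun β => ?_⟩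
    · rintro ⟨a, b⟩ ⟨a', b'⟩ h
      simpa using h
    · refine (Matrix.rank_le_card_of_support_subset _
        (Finset.univ.map (Fin.castLEEmb hr1)) ?_).trans (by simp)
      rw [Function.support_subset_iff']
      intro i hi
      funext j
      refine Finset.sum_eq_zero fun k _ => if_neg fun hk => hi ?_
      simp only [Finset.coe_map, Set.mem_image]
      exact ⟨k.1, by simp, congrArg Prod.fst hk⟩
  · refine ⟨Fin d₁ × Fin r, inferInstance, inferInstance,
      fun k => (k.1, Fin.castLE hr2 k.2), ?_, by simp [h, mul_comm], fun β => ?_⟩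
    · rintro ⟨a, b⟩ ⟨a', b'⟩ h
      simpa using h
    · rw [← Matrix.rank_transpose]
      refine (Matrix.rank_le_card_of_support_subset _
        (Finset.univ.map (Fin.castLEEmb hr2)) ?_).trans (by simp)
      rw [Function.support_subset_iff']
      intro j hj
      funext i
      refine Finset.sum_eq_zero fun k _ => if_neg fun hk => hj ?_
      simp only [Finset.coe_map, Set.mem_image]
      exact ⟨k.2, by simp, congrArg Prod.snd hk⟩

/-- The condition `δ ≤ C₂ n^(-(1 + γ))` makes `n δ` as small as required for all large `n`. -/
theorem exists_sample_size_threshold (H C₂ γ : ℝ) (hH : 0 ≤ H) (hC₂ : 0 < C₂) (hγ : 0 < γ) :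
    ∃ N : ℝ, 1 ≤ N ∧ ∀ (n : ℕ) (δ : ℝ), N ≤ n → δ ≤ C₂ * (n : ℝ) ^ (-(1 + γ)) →
      n * δ * H ≤ 1 / 4 := by
  refine ⟨(4 * C₂ * H + 1) ^ (1 / γ), Real.one_le_rpow (by nlinarith [mul_nonneg hC₂.le hH])
    (by positivity), fun n δ hn hδ => ?_⟩
  have hn0 : (0 : ℝ) < n := lt_of_lt_of_le (by positivity) hn
  have h1 : 4 * C₂ * H + 1 ≤ (n : ℝ) ^ γ := by
    have := Real.rpow_le_rpow (by positivity) hn hγ.le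
    rwa [← Real.rpow_mul (by positivity), one_div_mul_cancel hγ.ne', Real.rpow_one] at this
  have h2 : (n : ℝ) * (n : ℝ) ^ (-(1 + γ)) = ((n : ℝ) ^ γ)⁻¹ := by
    rw [← Real.rpow_neg hn0.le, show -γ = 1 + -(1 + γ) by ring, Real.rpow_add hn0, Real.rpow_one]
  have h3 : n * δ ≤ C₂ * ((n : ℝ) ^ γ)⁻¹ := by
    rw [← h2]
    calc n * δ ≤ n * (C₂ * (n : ℝ) ^ (-(1 + γ))) := by gcongr
      _ = _ := by ring
  have hpos : 0 < (n : ℝ) ^ γ := by positivity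
  calc n * δ * H ≤ C₂ * ((n : ℝ) ^ γ)⁻¹ * H := by gcongr
    _ = C₂ * H / (n : ℝ) ^ γ := by ring
    _ ≤ 1 / 4 := by rw [div_le_iff₀ hpos]; linarith

end

end TraceRegression

theorem mainTheorem5 (Cl Cu C₁ C₂ γ : ℝ) (hCl : 0 < Cl) (hCu : 0 < Cu) (hC₁ : 0 < C₁)
    (hC₂ : 0 < C₂) (hγ : 0 < γ) :
    ∃ c : ℝ, 0 < c ∧
      ∀ (n d₁ d₂ r : ℕ) (σ ε δ : ℝ)
        (Λ : Fin n → Matrix (Fin d₂ × Fin d₁) (Fin d₂ × Fin d₁) ℝ),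
        1 ≤ n → 1 ≤ r → r ≤ min d₁ d₂ → 0 < σ →
        TraceRegression.IsGaussianDesignCov Cl Cu Λ →
        (r : ℝ) * (max d₁ d₂ : ℕ) ≤ C₁ * (n * ε) →
        0 < ε → ε < 1 → 0 ≤ δ → δ ≤ C₂ * (n : ℝ) ^ (-(1 + γ)) →
        ENNReal.ofReal (c * (σ ^ 2 * (r * (max d₁ d₂ : ℕ)) / n
            + σ ^ 2 * (r ^ 2 * (max d₁ d₂ : ℕ) ^ 2) / (n ^ 2 * ε ^ 2)))
          ≤ TraceRegression.minimaxRisk σ ε δ Λ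
              (⋃ k ∈ Set.Icc 1 r, TraceRegression.rankSet d₁ d₂ k) := by
  open TraceRegression in
  obtain ⟨N, hN1, hN⟩ := exists_sample_size_threshold (privacyConst Cu C₁) C₂ γ
    (privacyConst_nonneg hCu C₁) hC₂ hγ
  have hN0 : 0 < N := by linarith
  refine ⟨min (1 / (8 * Cu)) (min (1 / (128 * Cu)) (1 / (8 * Cu * (C₁ ^ 2 * N)))) / 2,
    by positivity, ?_⟩
  intro n d₁ d₂ r σ ε δ Λ hn hr hrd hσ hΛ hrn hε hε1 hδ hδn
  set c := min (1 / (8 * Cu)) (min (1 / (128 * Cu)) (1 / (8 * Cu * (C₁ ^ 2 * N))))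
  refine le_iInf₂ fun A hA => ?_
  have hAm := hA.isMarkov
  set S := ⨆ M ∈ ⋃ k ∈ Set.Icc 1 r, rankSet d₁ d₂ k, risk σ Λ A M
  by_cases hStop : S = ⊤
  · rw [hStop]; exact le_top
  rw [← ENNReal.ofReal_toReal hStop]
  refine ENNReal.ofReal_le_ofReal ?_
  obtain ⟨ι, _, _, e, he, hcard, hrank⟩ := exists_low_rank_coordinates hr hrd
  have hs : ∀ β ≠ 0, linRisk (entries e) σ (fun i => designLaw (Λ i)) A (entries e) β ≤
      ENNReal.ofReal S.toReal := fun β hβ => by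
    rw [ENNReal.ofReal_toReal hStop]
    refine (linRisk_entries_le he σ Λ A β).trans (le_iSup₂_of_le (embed e β) ?_ le_rfl)
    simp only [Set.mem_iUnion, Set.mem_Icc]
    exact ⟨_, ⟨one_le_rank_of_ne_zero (embed_ne_zero he hβ), hrank β⟩, rfl⟩
  have hμ : ∀ i, IsBoundedDesign (entries e) Cu (designLaw (Λ i)) := fun i => by
    obtain ⟨h, hk⟩ := hΛ i
    exact isBoundedDesign_designLaw he h fun k => (hk k).2
  have hp : (Fintype.card ι : ℝ) = r * (max d₁ d₂ : ℕ) := by rw [hcard]; push_cast; ring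
  have hn0 : (0 : ℝ) < n := by exact_mod_cast hn
  have hp1 : (1 : ℝ) ≤ Fintype.card ι := by exact_mod_cast Fintype.card_pos (α := ι)
  have hmE := measurable_entries e
  have hcl := le_of_linRisk_le hμ hmE hmE hσ hCu hn ENNReal.toReal_nonneg hs
  rw [← hp] at hrn
  have hgoal : σ ^ 2 * (r * (max d₁ d₂ : ℕ)) / n
        + σ ^ 2 * (r ^ 2 * (max d₁ d₂ : ℕ) ^ 2) / (n ^ 2 * ε ^ 2) =
      σ ^ 2 * Fintype.card ι / n + σ ^ 2 * Fintype.card ι ^ 2 / (n ^ 2 * ε ^ 2) := by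
    rw [hp, mul_pow]
  rw [hgoal]
  set p : ℝ := (Fintype.card ι : ℝ)
  set V₁ := σ ^ 2 * p / n with hV₁
  set V₂ := σ ^ 2 * p ^ 2 / (n ^ 2 * ε ^ 2) with hV₂
  have hV₁0 : 0 ≤ V₁ := by positivity
  have hV₂0 : 0 ≤ V₂ := by positivity
  have b1 : c * V₁ ≤ S.toReal :=
    (mul_le_mul_of_nonneg_right (min_le_left _ _) hV₁0).trans hcl
  have b2 : c * V₂ ≤ S.toReal := by
    by_cases hNn : N ≤ n
    · refine le_trans (mul_le_mul_of_nonneg_right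
        ((min_le_right _ _).trans (min_le_left _ _)) hV₂0) ?_
      refine le_of_linRisk_le_of_private hμ hmE hmE hσ hCu hn ENNReal.toReal_nonneg hs hε hε1 hδ
        (fun i Z Z' hZ Q hQ => hA.private_ineq Z Z' ⟨i, hZ⟩ Q hQ) hrn (hN n δ hNn hδn)
    · -- For `n < N` the condition `1 ≤ p ≤ C₁ n ε` bounds `1 / ε` by `C₁ N`, so that the second
      -- rate is at most a constant multiple of the first.
      have hε' : 1 ≤ C₁ * (n * ε) := hp1.trans hrn
      have h21 : V₂ ≤ C₁ ^ 2 * N * V₁ := by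
        have e1 : C₁ ^ 2 * N * V₁ = C₁ ^ 2 * N * (σ ^ 2 * p) * (n * ε ^ 2) / (n ^ 2 * ε ^ 2) := by
          rw [hV₁]; field_simp
        rw [e1, hV₂]
        refine div_le_div_of_nonneg_right ?_ (by positivity)
        have h1 : p * 1 ≤ (C₁ * (n * ε)) * (C₁ * (n * ε)) := by gcongr
        have h2 : (C₁ * (n * ε)) * (C₁ * (n * ε)) ≤ C₁ ^ 2 * N * (n * ε ^ 2) := by
          have : (n : ℝ) ≤ N := (not_le.1 hNn).le
          calc (C₁ * (n * ε)) * (C₁ * (n * ε)) = C₁ ^ 2 * n * (n * ε ^ 2) := by ring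
            _ ≤ _ := by gcongr
        have h3 : 0 ≤ σ ^ 2 * p := by positivity
        linarith [mul_le_mul_of_nonneg_left (h1.trans h2) h3]
      calc c * V₂ ≤ 1 / (8 * Cu * (C₁ ^ 2 * N)) * (C₁ ^ 2 * N * V₁) := by
            gcongr
            exact (min_le_right _ _).trans (min_le_right _ _)
        _ = 1 / (8 * Cu) * V₁ := by field_simp
        _ ≤ _ := hcl
  linarith
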